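/- Let $H_1,H_2$ be complex Hilbert spaces, let $\Omega_1,\Omega_2$ be (possibly unbounded) self-adjoint operators in $H_1$ and $H_2$, let $\Gamma:H_2\to H_1$ be a bounded linear operator, and on $\mathcal H=H_1\oplus H_2$ let $$\Omega=\begin{pmatrix}\Omega_1&\Gamma\\ \Gamma^\dagger&\Omega_2\end{pmatrix},\qquad \mathrm{Dom}\,\Omega=\mathrm{Dom}\,\Omega_1\oplus\mathrm{Dom}\,\Omega_2 .$$ For a self-adjoint operator $A$ in a Hilbert space $H$ and $S\subseteq H$, let $\mathcal O_A(S)$ be the closure of the span of $\{f(A)w: f\in C_c(\mathbb R),\,w\in S\}$; a closed subspace $K$ is called $A$-invariant if $\mathcal O_A(K)=K$. Put $a_1(t)=\Gamma e^{-i\Omega_2t}\Gamma^\dagger$ and $a_2(t)=\Gamma^\dagger e^{-i\Omega_1t}\Gamma$. An open system $(H_1,\Omega_1,a)$, with $a(t)$ an operator-valued function on $t\ge 0$, has the *minimal conservative extension* $(H_1\oplus G,\ \Omega_1,\ \Omega_G,\ \Gamma_G)$ if $\Omega_1$ and $\Omega_G$ are self-adjoint in $H_1$ and $G$, $\Gamma_G:G\to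 H_1$ is bounded, $a(t)=\Gamma_Ge^{-i\Omega_Gt}\Gamma_G^\dagger$ for all $t\ge0$, and $\mathcal O_{\Omega_G}(\mathrm{Ran}\,\Gamma_G^\dagger)=G$; similarly with the two components exchanged. It is *contained in* $\mathcal H$ if it is the restriction of $(\mathcal H,\Omega)$ to an $\Omega$-invariant closed subspace of $\mathcal H$ of the form $H_1\oplus G$ with $G\subseteq H_2$. A coupled system $(H_1\oplus H_2,\Omega)$ is *reconstructible* if it is a minimal conservative extension of each of its open systems $(H_1,\Omega_1,a_1)$ and $(H_2,\Omega_2,a_2)$. Then among the closed subspaces $K$ of $\mathcal H$ such that (a) $K$ is $\Omega$-invariant, (b) $K=K_1\oplus K_2$ with $K_i\subseteq H_i$, and (c) $\mathrm{Ran}\,\Gamma\subseteq K$, there is a smallest one, $\mathcal H'=H_{1c}\oplus H_{2c}$, and it is the only minimal one; the restriction $\Omega\!\upharpoonright\!\mathcal H'$ is self-adjoint, $\Gamma(H_{2c})\subseteq H_{1c}$ and $\Gamma^\dagger(H_{1c})\subseteq H_{2c}$. With $\Omega_{ic}=\Omega_i\!\upharpoonright\! H_{ic}$ and $\Gamma_c=\Gamma\!\upharpoonright\!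 H_{2c}:H_{2c}\to H_{1c}$ the following hold. (i) $H_{1c}=\mathcal O_{\Omega_1}(\mathrm{Ran}\,\Gamma)$ and $H_{2c}=\mathcal O_{\Omega_2}(\mathrm{Ran}\,\Gamma^\dagger)$. (ii) The subsystem $(\mathcal H',\Omega\!\upharpoonright\!\mathcal H')$ is reconstructible. $H_1\oplus H_{2c}=\mathcal O_\Omega(H_1)$ is the unique minimal conservative extension of $(H_1,\Omega_1,a_1)$ contained in $\mathcal H$, and $H_{1c}\oplus H_2=\mathcal O_\Omega(H_2)$ is the unique minimal conservative extension of $(H_2,\Omega_2,a_2)$ contained in $\mathcal H$. (iii) For all $t$: $a_1(t)\!\upharpoonright\! H_{1c}=\Gamma_ce^{-i\Omega_{2c}t}\Gamma_c^\dagger$ and $a_1(t)\!\upharpoonright\!(H_1\ominus H_{1c})=0$; $a_2(t)\!\upharpoonright\! H_{2c}=\Gamma_c^\dagger e^{-i\Omega_{1c}t}\Gamma_c$ and $a_2(t)\!\upharpoonright\!(H_2\ominus H_{2c})=0$. Moreover, neither $a_1$ nor $a_2$ is determined by any $\Omega$-invariant subspace $\tilde H_1\oplus\tilde H_2\subsetneq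 H_{1c}\oplus H_{2c}$ with $\tilde H_i\subseteq H_i$. Here $\tilde H_1\oplus\tilde H_2$ *determines* $a_1$ if, for all $t\ge0$, $a_1(t)\!\upharpoonright\!\tilde H_1$ is the corresponding friction function $\tilde\Gamma e^{-i\tilde\Omega_2t}\tilde\Gamma^\dagger$ of the restricted system and $a_1(t)$ vanishes on $H_1\ominus\tilde H_1$; similarly for $a_2$. (iv) $(H_1\oplus H_2,\Omega)$ is reconstructible if and only if neither $H_1$ nor $H_2$ contains a nonzero $\Omega$-invariant closed subspace (where $H_1$ and $H_2$ themselves count as such subspaces when they are $\Omega$-invariant). -/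

import Mathlib

open Filter Topology
open scoped CompactlySupported ENNReal

noncomputable section

namespace LinearPMap

section Operator

variable {H : Type*} [NormedAddCommGroup H] [InnerProductSpace ℂ H]

/-- `R` is the bounded inverse `(A + i)⁻¹` of `A + i`: every `R v` lies in the domain of `A`
and `(A + i) (R v) = v`. For self-adjoint `A` there is exactly one such `R`. -/
def IsResolventAtNegI (A : H →ₗ.[ℂ] H) (R : H →L[ℂ] H) : Prop :=
  ∀ v : H, ∃ h : R v ∈ A.domain, A ⟨R v, h⟩ + Complex.I • R v = v

open Classical in
/-- The bounded operator `(A + i)⁻¹` (zero if it does not exist). -/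
def resolventAtNegI (A : H →ₗ.[ℂ] H) : H →L[ℂ] H :=
  if h : ∃ R : H →L[ℂ] H, A.IsResolventAtNegI R then h.choose else 0

/-- The Cayley transform `U = (A - i) (A + i)⁻¹ = 1 - 2 i (A + i)⁻¹`, a unitary operator when `A`
is self-adjoint. -/
def cayley (A : H →ₗ.[ℂ] H) : H →L[ℂ] H :=
  1 - (2 * Complex.I) • A.resolventAtNegI

/-- The function on the unit circle corresponding to the function `f` on the real line under the
Cayley map `lam ↦ z = (lam - i) / (lam + i)`, whose inverse is `z ↦ i (1 + z) / (1 - z)`;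
the point `z = 1` corresponds to infinity, where the value is `0`. -/
def onCircle (f : ℝ → ℂ) (z : ℂ) : ℂ :=
  if z = 1 then 0 else f (Complex.I * (1 + z) / (1 - z)).re

/-- The restriction `A ↾ K` of a (possibly unbounded) operator to a closed subspace `K`, as an
operator in `K`: its domain consists of the `v ∈ K ∩ Dom A` with `A v ∈ K` (the last condition
being automatic when `K` is invariant). -/
def restrictTo (A : H →ₗ.[ℂ] H) (K : ClosedSubmodule ℂ H) :
    K.toSubmodule →ₗ.[ℂ] K.toSubmodule where
  domain :=
    { carrier := {v | ∃ h : (v : H) ∈ A.domain, A ⟨v, h⟩ ∈ K}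
      zero_mem' := ⟨A.domain.zero_mem, by
        have h : A (⟨((0 : K.toSubmodule) : H), A.domain.zero_mem⟩ : A.domain) = 0 := A.map_zero
        rw [h]; exact K.toSubmodule.zero_mem⟩
      add_mem' := by
        rintro v w ⟨hv, hv'⟩ ⟨hw, hw'⟩
        refine ⟨A.domain.add_mem hv hw, ?_⟩
        have h := A.map_add ⟨(v : H), hv⟩ ⟨(w : H), hw⟩
        have h2 := K.toSubmodule.add_mem hv' hw'
        rw [← h] at h2; exact h2
      smul_mem' := by
        rintro c v ⟨hv, hv'⟩
        refine ⟨A.domain.smul_mem c hv, ?_⟩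
        have h := A.map_smul c ⟨(v : H), hv⟩
        have h2 := K.toSubmodule.smul_mem c hv'
        rw [← h] at h2; exact h2 }
  toFun :=
    { toFun := fun v => ⟨A ⟨((v : K.toSubmodule) : H), v.2.choose⟩, v.2.choose_spec⟩
      map_add' := fun v w =>
        Subtype.ext (A.map_add ⟨((v : K.toSubmodule) : H), v.2.choose⟩
          ⟨((w : K.toSubmodule) : H), w.2.choose⟩)
      map_smul' := fun c v =>
        Subtype.ext (A.map_smul c ⟨((v : K.toSubmodule) : H), v.2.choose⟩) }

variable [CompleteSpace H]

/-- The operator `f(A)` for a self-adjoint operator `A` (bounded or not) and a continuous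
compactly supported function `f : ℝ → ℂ`, obtained from the continuous functional calculus of the
Cayley transform of `A`. -/
def applyFun (A : H →ₗ.[ℂ] H) (f : ℝ → ℂ) : H →L[ℂ] H :=
  cfc (onCircle f) A.cayley

/-- The continuous cutoff that is `1` on `[-n, n]`, is `0` off `[-(n+1), n+1]` and is
affine in between. -/
def cutoff (n : ℕ) (x : ℝ) : ℝ := max 0 (min 1 (n + 1 - |x|))

open Classical in
/-- The unitary operator `exp (-i t A)` for a self-adjoint operator `A` (bounded or not): the
strong limit, as `n → ∞`, of `fₙ(A)` with `fₙ(x) = cutoff n x * exp (-i t x)`. -/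
def expNegI (A : H →ₗ.[ℂ] H) (t : ℝ) : H →L[ℂ] H :=
  if h : ∃ T : H →L[ℂ] H, ∀ v : H, Tendsto
      (fun n : ℕ => A.applyFun
        (fun x => (cutoff n x : ℂ) * Complex.exp (-(Complex.I * t * x))) v) atTop (𝓝 (T v))
  then h.choose else 0

/-- The closed orbit of a set `S` of vectors under `A`: the closure of the span of all `f(A) w`
with `w ∈ S` and `f` continuous with compact support. -/
def orbit (A : H →ₗ.[ℂ] H) (S : Set H) : ClosedSubmodule ℂ H :=
  (Submodule.span ℂ {u : H | ∃ f : C_c(ℝ, ℂ), ∃ w ∈ S, u = A.applyFun f w}).closure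

/-- A closed subspace `K` is `A`-invariant if it equals its own orbit under `A`. -/
def IsInvariant (A : H →ₗ.[ℂ] H) (K : ClosedSubmodule ℂ H) : Prop :=
  A.orbit (K : Set H) = K

end Operator

end LinearPMap

instance ClosedSubmodule.instCompleteSpaceToSubmodule {H : Type*} [NormedAddCommGroup H]
    [InnerProductSpace ℂ H] [CompleteSpace H] (K : ClosedSubmodule ℂ H) :
    CompleteSpace K.toSubmodule :=
  K.isClosed.completeSpace_coe

/-- An open linear system `∂ₜ v(t) = -i Ω v(t) - ∫₀^∞ a(τ) v(t - τ) dτ + f(t)` in the Hilbert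
space `E`, given by its frequency operator and its friction function `a(t)`, `t ≥ 0`. -/
structure OpenSystem (E : Type*) [NormedAddCommGroup E] [InnerProductSpace ℂ E] where
  /-- the frequency operator -/
  Ω : E →ₗ.[ℂ] E
  /-- the friction function; only its values at `t ≥ 0` matter -/
  a : ℝ → E →L[ℂ] E

/-- The data of two coupled linear systems
`∂ₜ v₁ = -i Ω₁ v₁ - i Γ v₂ + f₁`, `∂ₜ v₂ = -i Γ† v₁ - i Ω₂ v₂ + f₂`
with bounded coupling operator `Γ : H₂ → H₁`. -/
structure CoupledSystem (H₁ H₂ : Type*) [NormedAddCommGroup H₁] [InnerProductSpace ℂ H₁]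
    [NormedAddCommGroup H₂] [InnerProductSpace ℂ H₂] where
  /-- the frequency operator in the first space -/
  Ω₁ : H₁ →ₗ.[ℂ] H₁
  /-- the frequency operator in the second space -/
  Ω₂ : H₂ →ₗ.[ℂ] H₂
  /-- the coupling operator -/
  Γ : H₂ →L[ℂ] H₁

namespace CoupledSystem

variable {H₁ H₂ : Type*} [NormedAddCommGroup H₁] [InnerProductSpace ℂ H₁] [CompleteSpace H₁]
  [NormedAddCommGroup H₂] [InnerProductSpace ℂ H₂] [CompleteSpace H₂]

/-- The system is conservative: the two frequency operators are (densely defined and)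
self-adjoint. -/
def IsConservative (S : CoupledSystem H₁ H₂) : Prop :=
  IsSelfAdjoint S.Ω₁ ∧ IsSelfAdjoint S.Ω₂

/-- The same system with the roles of the two components exchanged. -/
def swap (S : CoupledSystem H₁ H₂) : CoupledSystem H₂ H₁ where
  Ω₁ := S.Ω₂
  Ω₂ := S.Ω₁
  Γ := S.Γ.adjoint

/-- The frequency operator `Ω = [Ω₁ Γ; Γ† Ω₂]` of the whole system, in the Hilbert space
`H₁ ⊕ H₂`, with domain `Dom Ω₁ ⊕ Dom Ω₂`. -/
def Ω (S : CoupledSystem H₁ H₂) :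
    WithLp 2 (H₁ × H₂) →ₗ.[ℂ] WithLp 2 (H₁ × H₂) where
  domain := S.Ω₁.domain.comap (WithLp.fstₗ 2 ℂ H₁ H₂) ⊓ S.Ω₂.domain.comap (WithLp.sndₗ 2 ℂ H₁ H₂)
  toFun :=
    { toFun := fun x => WithLp.toLp 2
        (S.Ω₁ ⟨x.1.fst, x.2.1⟩ + S.Γ x.1.snd, S.Γ.adjoint x.1.fst + S.Ω₂ ⟨x.1.snd, x.2.2⟩)
      map_add' := by
        intro x y
        have h₁ := S.Ω₁.map_add ⟨x.1.fst, x.2.1⟩ ⟨y.1.fst, y.2.1⟩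
        have h₂ := S.Ω₂.map_add ⟨x.1.snd, x.2.2⟩ ⟨y.1.snd, y.2.2⟩
        rw [← WithLp.toLp_add, Prod.mk_add_mk]
        refine congrArg (WithLp.toLp 2) (Prod.ext ?_ ?_)
        · refine (congrArg₂ (· + ·) h₁ (S.Γ.map_add x.1.snd y.1.snd)).trans ?_
          exact add_add_add_comm _ _ _ _
        · refine (congrArg₂ (· + ·) (S.Γ.adjoint.map_add x.1.fst y.1.fst) h₂).trans ?_
          exact add_add_add_comm _ _ _ _
      map_smul' := by
        intro c x
        have h₁ := S.Ω₁.map_smul c ⟨x.1.fst, x.2.1⟩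
        have h₂ := S.Ω₂.map_smul c ⟨x.1.snd, x.2.2⟩
        rw [RingHom.id_apply, ← WithLp.toLp_smul, Prod.smul_mk]
        refine congrArg (WithLp.toLp 2) (Prod.ext ?_ ?_)
        · refine (congrArg₂ (· + ·) h₁ (S.Γ.map_smul c x.1.snd)).trans ?_
          exact (smul_add _ _ _).symm
        · refine (congrArg₂ (· + ·) (S.Γ.adjoint.map_smul c x.1.fst) h₂).trans ?_
          exact (smul_add _ _ _).symm }

/-- The friction function `a₁(t) = Γ exp(-i t Ω₂) Γ†` of the first open system. -/
def a₁ (S : CoupledSystem H₁ H₂) (t : ℝ) : H₁ →L[ℂ] H₁ :=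
  S.Γ ∘L S.Ω₂.expNegI t ∘L S.Γ.adjoint

/-- The friction function `a₂(t) = Γ† exp(-i t Ω₁) Γ` of the second open system. -/
def a₂ (S : CoupledSystem H₁ H₂) (t : ℝ) : H₂ →L[ℂ] H₂ :=
  S.Γ.adjoint ∘L S.Ω₁.expNegI t ∘L S.Γ

/-- The open system obtained by projecting the dynamics to `H₁`. -/
def openSystem₁ (S : CoupledSystem H₁ H₂) : OpenSystem H₁ := ⟨S.Ω₁, S.a₁⟩

/-- The open system obtained by projecting the dynamics to `H₂`. -/
def openSystem₂ (S : CoupledSystem H₁ H₂) : OpenSystem H₂ := ⟨S.Ω₂, S.a₂⟩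

/-- `T`, with state space `H₁ ⊕ H₂`, is a minimal conservative extension of the open system `O`
in `H₁`: it is conservative, its first component has the internal dynamics and the friction
function of `O`, and the orbit of `Ran Γ†` under the frequency operator of the second component
is all of `H₂`. -/
def IsMinimalConservativeExtension (O : OpenSystem H₁) (T : CoupledSystem H₁ H₂) : Prop :=
  T.IsConservative ∧ T.Ω₁ = O.Ω ∧ (∀ t : ℝ, 0 ≤ t → T.a₁ t = O.a t) ∧
    T.Ω₂.orbit (Set.range T.Γ.adjoint) = ⊤

/-- A system is reconstructible if it is the minimal conservative extension of each of its two
open projected systems. -/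
def IsReconstructible (S : CoupledSystem H₁ H₂) : Prop :=
  IsMinimalConservativeExtension S.openSystem₁ S ∧
    IsMinimalConservativeExtension S.openSystem₂ S.swap

/-- The closed subspace `K₁ ⊕ K₂` of `H₁ ⊕ H₂`. -/
def directSum (K₁ : ClosedSubmodule ℂ H₁) (K₂ : ClosedSubmodule ℂ H₂) :
    ClosedSubmodule ℂ (WithLp 2 (H₁ × H₂)) :=
  K₁.comap (WithLp.fstL 2 ℂ H₁ H₂) ⊓ K₂.comap (WithLp.sndL 2 ℂ H₁ H₂)

/-- The closed subspace `K` of `H₁ ⊕ H₂` is `Ω`-invariant, splits as `K₁ ⊕ K₂` with `Kᵢ` in `Hᵢ`,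
and contains `Ran Γ` (regarded as a subset of `H₁ ⊕ H₂`). -/
def IsSplitInvariantContainingRange (S : CoupledSystem H₁ H₂)
    (K : ClosedSubmodule ℂ (WithLp 2 (H₁ × H₂))) : Prop :=
  S.Ω.IsInvariant K ∧
    (∃ (K₁ : ClosedSubmodule ℂ H₁) (K₂ : ClosedSubmodule ℂ H₂), K = directSum K₁ K₂) ∧
    ∀ w : H₂, WithLp.toLp 2 (S.Γ w, (0 : H₂)) ∈ K

/-- The system on `K₁ ⊕ K₂` with frequency operators `Ω₁ ↾ K₁`, `Ω₂ ↾ K₂` and the coupling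
operator `Γ` compressed to `K₂ → K₁`; if `K₁ ⊕ K₂` is `Ω`-invariant then `Γ` maps `K₂` into `K₁`
and `Γ†` maps `K₁` into `K₂`, so this is the restriction of the system to `K₁ ⊕ K₂`. -/
def subsystem (S : CoupledSystem H₁ H₂) (K₁ : ClosedSubmodule ℂ H₁) (K₂ : ClosedSubmodule ℂ H₂) :
    CoupledSystem K₁.toSubmodule K₂.toSubmodule where
  Ω₁ := S.Ω₁.restrictTo K₁
  Ω₂ := S.Ω₂.restrictTo K₂
  Γ := K₁.toSubmodule.subtypeL.adjoint ∘L S.Γ ∘L K₂.toSubmodule.subtypeL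

/-- The system on `H₁ ⊕ K₂` obtained by restricting the second component to `K₂`. -/
def restrictSnd (S : CoupledSystem H₁ H₂) (K₂ : ClosedSubmodule ℂ H₂) :
    CoupledSystem H₁ K₂.toSubmodule where
  Ω₁ := S.Ω₁
  Ω₂ := S.Ω₂.restrictTo K₂
  Γ := S.Γ ∘L K₂.toSubmodule.subtypeL

/-- The closed subspace `K` of `H₁ ⊕ H₂` is a minimal conservative extension of the first open
system contained in the whole system: `K` is `Ω`-invariant, has the form `H₁ ⊕ K₂`, and the
restriction of the system to `H₁ ⊕ K₂` is a minimal conservative extension of the first open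
system. -/
def IsMinimalExtensionWithin₁ (S : CoupledSystem H₁ H₂)
    (K : ClosedSubmodule ℂ (WithLp 2 (H₁ × H₂))) : Prop :=
  S.Ω.IsInvariant K ∧ ∃ K₂ : ClosedSubmodule ℂ H₂, K = directSum ⊤ K₂ ∧
    IsMinimalConservativeExtension S.openSystem₁ (S.restrictSnd K₂)

/-- The analogue for the second open system and subspaces of the form `K₁ ⊕ H₂`. -/
def IsMinimalExtensionWithin₂ (S : CoupledSystem H₁ H₂)
    (K : ClosedSubmodule ℂ (WithLp 2 (H₁ × H₂))) : Prop :=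
  S.Ω.IsInvariant K ∧ ∃ K₁ : ClosedSubmodule ℂ H₁, K = directSum K₁ ⊤ ∧
    IsMinimalConservativeExtension S.openSystem₂ (S.swap.restrictSnd K₁)

/-- The subsystem on `K₁ ⊕ K₂` determines `a₁`: on `K₁`, `a₁` is the friction function of the
subsystem, and `a₁` vanishes on `H₁ ⊖ K₁`. -/
def Determines₁ (S : CoupledSystem H₁ H₂) (K₁ : ClosedSubmodule ℂ H₁)
    (K₂ : ClosedSubmodule ℂ H₂) : Prop :=
  ∀ t : ℝ, 0 ≤ t →
    (∀ v : K₁.toSubmodule, S.a₁ t v = ((S.subsystem K₁ K₂).a₁ t v : K₁.toSubmodule)) ∧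
    ∀ v ∈ K₁.toSubmoduleᗮ, S.a₁ t v = 0

/-- The subsystem on `K₁ ⊕ K₂` determines `a₂`: on `K₂`, `a₂` is the friction function of the
subsystem, and `a₂` vanishes on `H₂ ⊖ K₂`. -/
def Determines₂ (S : CoupledSystem H₁ H₂) (K₁ : ClosedSubmodule ℂ H₁)
    (K₂ : ClosedSubmodule ℂ H₂) : Prop :=
  ∀ t : ℝ, 0 ≤ t →
    (∀ v : K₂.toSubmodule, S.a₂ t v = ((S.subsystem K₁ K₂).a₂ t v : K₂.toSubmodule)) ∧
    ∀ v ∈ K₂.toSubmoduleᗮ, S.a₂ t v = 0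

end CoupledSystem

end

/-! For self-adjoint `A`, a closed subspace `K` is its own orbit exactly when the orthogonal
projection onto `K` commutes with `A` (`isInvariant_iff`). The projection onto `K₁ ⊕ K₂` is block
diagonal, so commuting with `Ω` decouples: each `Kᵢ` is `Ωᵢ`-invariant, `Γ` maps `K₂` into `K₁`, and
`Γ†` maps `K₁` into `K₂` (`isInvariant_directSum_iff`). After that the theorem is mostly a
comparison of subspaces.

If also `Ran Γ ⊆ K₁`, then `Γ†` vanishes on `K₁ᗮ`, so all of `Ran Γ†` lies in `K₂`. Hence `K`
contains both orbits of the coupling ranges, and their direct sum is itself admissible. The same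
criterion identifies the orbits of `H₁` and `H₂` under `Ω` and the minimal extensions.

Friction functions restrict because the inclusion of an invariant subspace intertwines the
restricted operator with the full one. Intertwining passes to the resolvents, the Cayley transforms,
`f(A)` and finally `exp(-itA)`. Conversely `a₁(0) = Γ Γ†`, so where `a₁(0)` vanishes so does `Γ†`; a
determining subspace therefore contains `Ran Γ`, and an invariant one cannot be properly smaller.
For (iv), `K₁ ⊕ 0` is invariant iff `K₁` is `Ω₁`-invariant and killed by `Γ†`; the largest such `K₁`
is the complement of the orbit of `Ran Γ`. -/

noncomputable section

namespace LinearPMap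

/-! ### Self-adjointness through graphs, the resolvent and the Cayley transform. -/

section SelfAdjoint

variable {H : Type*} [NormedAddCommGroup H] [InnerProductSpace ℂ H] [CompleteSpace H]
  {A : H →ₗ.[ℂ] H}

/-- A densely defined operator is self-adjoint iff its graph consists exactly of the pairs
`(x, w)` that satisfy the defining relation of the adjoint. -/
theorem isSelfAdjoint_iff_graph (A : H →ₗ.[ℂ] H) :
    IsSelfAdjoint A ↔ Dense (A.domain : Set H) ∧ ∀ x w : H, (x, w) ∈ A.graph ↔
      ∀ y z : H, (y, z) ∈ A.graph → inner ℂ z x = inner ℂ y w := by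
  have key (hd : Dense (A.domain : Set H)) (x w : H) : (x, w) ∈ A.adjoint.graph ↔
      ∀ y z : H, (y, z) ∈ A.graph → inner ℂ z x = inner ℂ y w := by
    rw [adjoint_graph_eq_graph_adjoint hd, Submodule.mem_adjoint_iff]
    simp only [sub_eq_zero]
  constructor
  · intro h
    refine ⟨h.dense_domain, fun x w => ?_⟩
    rw [← key h.dense_domain, isSelfAdjoint_def.1 h]
  · rintro ⟨hd, h⟩
    refine isSelfAdjoint_def.2 (eq_of_eq_graph ?_)
    ext ⟨x, w⟩
    rw [key hd, h]

theorem inner_eq_of_mem_graph (hA : IsSelfAdjoint A) {x w y z : H} (h : (x, w) ∈ A.graph)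
    (h' : (y, z) ∈ A.graph) : inner ℂ z x = inner ℂ y w :=
  (((isSelfAdjoint_iff_graph A).1 hA).2 x w).1 h y z h'

theorem mem_graph_of_inner (hA : IsSelfAdjoint A) {x w : H}
    (h : ∀ y z : H, (y, z) ∈ A.graph → inner ℂ z x = inner ℂ y w) : (x, w) ∈ A.graph :=
  (((isSelfAdjoint_iff_graph A).1 hA).2 x w).2 h

/-- The cross term is the imaginary part of the real number `⟪A x, x⟫`. The identity makes `A + i`
bounded below; its companion with `-i` excludes the eigenvalue `i`. -/
theorem norm_add_I_smul_sq (hA : IsSelfAdjoint A) {x y : H} (h : (x, y) ∈ A.graph) :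
    ‖y + Complex.I • x‖ ^ 2 = ‖y‖ ^ 2 + ‖x‖ ^ 2 := by
  have h1 := inner_eq_of_mem_graph hA h h
  have h2 : (inner ℂ y x).im = 0 := by
    have := congrArg Complex.im h1
    rw [← inner_conj_symm x y, Complex.conj_im] at this
    linarith
  rw [norm_add_sq (𝕜 := ℂ), norm_smul, inner_smul_right]
  simp [h2]

theorem norm_sub_I_smul_sq (hA : IsSelfAdjoint A) {x y : H} (h : (x, y) ∈ A.graph) :
    ‖y - Complex.I • x‖ ^ 2 = ‖y‖ ^ 2 + ‖x‖ ^ 2 := by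
  have h1 := inner_eq_of_mem_graph hA h h
  have h2 : (inner ℂ y x).im = 0 := by
    have := congrArg Complex.im h1
    rw [← inner_conj_symm x y, Complex.conj_im] at this
    linarith
  rw [norm_sub_sq (𝕜 := ℂ), norm_smul, inner_smul_right]
  simp [h2]

/-- `A + i` is a bounded map on the graph, which is complete since `A` is closed. Being bounded
below it is injective with closed range, and a vector orthogonal to the range would be an
eigenvector for `i`. -/
theorem exists_isResolventAtNegI (hA : IsSelfAdjoint A) :
    ∃ R : H →L[ℂ] H, A.IsResolventAtNegI R := by
  have hcl : _root_.IsClosed (A.graph : Set (H × H)) := hA.isClosed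
  have : CompleteSpace A.graph := hcl.completeSpace_coe
  let T : A.graph →L[ℂ] H :=
    (ContinuousLinearMap.snd ℂ H H + Complex.I • ContinuousLinearMap.fst ℂ H H) ∘L
      A.graph.subtypeL
  have hT (g : A.graph) : T g = g.1.2 + Complex.I • g.1.1 := rfl
  have hbd (g : A.graph) : ‖g‖ ≤ 1 * ‖T g‖ := by
    have h := norm_add_I_smul_sq hA (x := g.1.1) (y := g.1.2) g.2
    rw [← hT] at h
    rw [one_mul]
    change max ‖g.1.1‖ ‖g.1.2‖ ≤ _
    refine max_le ?_ ?_ <;> refine le_of_sq_le_sq ?_ (norm_nonneg _) <;> rw [h] <;>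
      simp
  have hanti : AntilipschitzWith 1 T := AddMonoidHomClass.antilipschitz_of_bound T hbd
  have hrange : T.range = ⊤ := by
    have hc : _root_.IsClosed (T.range : Set H) := hanti.isClosed_range T.uniformContinuous
    have : CompleteSpace T.range := hc.completeSpace_coe
    rw [← Submodule.orthogonal_eq_bot_iff, Submodule.eq_bot_iff]
    intro x hx
    have hg : (x, Complex.I • x) ∈ A.graph := by
      refine mem_graph_of_inner hA fun y z hyz => ?_
      have h1 := (Submodule.mem_orthogonal _ _).1 hx (T ⟨(y, z), hyz⟩) ⟨_, rfl⟩
      rw [hT, inner_add_left, inner_smul_left] at h1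
      rw [inner_smul_right]
      simp only [Complex.conj_I] at h1
      linear_combination h1
    have h1 := norm_sub_I_smul_sq hA hg
    simp only [sub_self, norm_zero] at h1
    have : ‖x‖ ^ 2 = 0 := by nlinarith [sq_nonneg ‖Complex.I • x‖, sq_nonneg ‖x‖]
    simpa using this
  let e := ContinuousLinearEquiv.ofBijective T (LinearMap.ker_eq_bot.2 hanti.injective) hrange
  refine ⟨ContinuousLinearMap.fst ℂ H H ∘L A.graph.subtypeL ∘L (e.symm : H →L[ℂ] A.graph),
    fun v => ?_⟩
  obtain ⟨⟨g, hg⟩, rfl⟩ := e.surjective v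
  obtain ⟨h1, h2⟩ := A.mem_graph_iff'.1 hg
  subst h2
  simp only [ContinuousLinearMap.comp_apply, ContinuousLinearEquiv.coe_coe,
    ContinuousLinearEquiv.symm_apply_apply]
  exact ⟨h1.2, rfl⟩

theorem resolventAtNegI_mem_graph (hA : IsSelfAdjoint A) (v : H) :
    (A.resolventAtNegI v, v - Complex.I • A.resolventAtNegI v) ∈ A.graph := by
  have hex := exists_isResolventAtNegI hA
  have hR : A.IsResolventAtNegI A.resolventAtNegI := by
    rw [resolventAtNegI, dif_pos hex]
    exact hex.choose_spec
  obtain ⟨h, h'⟩ := hR v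
  rw [mem_graph_iff]
  exact ⟨⟨_, h⟩, rfl, eq_sub_of_add_eq h'⟩

theorem resolventAtNegI_apply (hA : IsSelfAdjoint A) {x y : H} (h : (x, y) ∈ A.graph) :
    A.resolventAtNegI (y + Complex.I • x) = x := by
  have h1 := A.graph.sub_mem (resolventAtNegI_mem_graph hA (y + Complex.I • x)) h
  have h2 := norm_add_I_smul_sq hA h1
  have h3 : (y + Complex.I • x - Complex.I • A.resolventAtNegI (y + Complex.I • x) - y) +
      Complex.I • (A.resolventAtNegI (y + Complex.I • x) - x) = 0 := by module
  rw [h3, norm_zero] at h2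
  have : ‖A.resolventAtNegI (y + Complex.I • x) - x‖ ^ 2 = 0 := by
    nlinarith [sq_nonneg
      ‖y + Complex.I • x - Complex.I • A.resolventAtNegI (y + Complex.I • x) - y‖,
      sq_nonneg ‖A.resolventAtNegI (y + Complex.I • x) - x‖]
  simpa [sub_eq_zero] using this

/-- The adjoint of `(A + i)⁻¹` is `(A - i)⁻¹`. -/
theorem adjoint_resolventAtNegI_mem_graph (hA : IsSelfAdjoint A) (v : H) :
    (A.resolventAtNegI.adjoint v, v + Complex.I • A.resolventAtNegI.adjoint v) ∈ A.graph := by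
  refine mem_graph_of_inner hA fun y z hyz => ?_
  have h := resolventAtNegI_apply hA hyz
  have h2 : inner ℂ (z + Complex.I • y) (A.resolventAtNegI.adjoint v) = inner ℂ y v := by
    rw [ContinuousLinearMap.adjoint_inner_right, h]
  rw [inner_add_left, inner_smul_left, Complex.conj_I] at h2
  rw [inner_add_right, inner_smul_right]
  linear_combination h2

theorem adjoint_resolventAtNegI_apply (hA : IsSelfAdjoint A) {x y : H} (h : (x, y) ∈ A.graph) :
    A.resolventAtNegI.adjoint (y - Complex.I • x) = x := by
  refine ext_inner_left ℂ fun u => ?_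
  have h1 := inner_eq_of_mem_graph hA h (resolventAtNegI_mem_graph hA u)
  rw [ContinuousLinearMap.adjoint_inner_right, inner_sub_right, inner_smul_right]
  rw [inner_sub_left, inner_smul_left, Complex.conj_I] at h1
  linear_combination -h1

/-- The first resolvent identity between the points `i` and `-i`. Both orders of the product are
needed, one for each of the two unitarity relations. -/
theorem adjoint_resolventAtNegI_sub (hA : IsSelfAdjoint A) :
    A.resolventAtNegI.adjoint - A.resolventAtNegI =
      (2 * Complex.I) • (A.resolventAtNegI.adjoint * A.resolventAtNegI) := by
  ext v
  have h := adjoint_resolventAtNegI_apply hA (resolventAtNegI_mem_graph hA v)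
  have h2 : v - Complex.I • A.resolventAtNegI v - Complex.I • A.resolventAtNegI v =
      v - (2 * Complex.I) • A.resolventAtNegI v := by module
  rw [h2, ContinuousLinearMap.map_sub, ContinuousLinearMap.map_smul] at h
  change A.resolventAtNegI.adjoint v - A.resolventAtNegI v =
    (2 * Complex.I) • A.resolventAtNegI.adjoint (A.resolventAtNegI v)
  rw [← sub_eq_zero] at h ⊢
  rw [← h]; abel

theorem adjoint_resolventAtNegI_sub' (hA : IsSelfAdjoint A) :
    A.resolventAtNegI.adjoint - A.resolventAtNegI =
      (2 * Complex.I) • (A.resolventAtNegI * A.resolventAtNegI.adjoint) := by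
  ext v
  have h := resolventAtNegI_apply hA (adjoint_resolventAtNegI_mem_graph hA v)
  have h2 : v + Complex.I • A.resolventAtNegI.adjoint v +
      Complex.I • A.resolventAtNegI.adjoint v =
      v + (2 * Complex.I) • A.resolventAtNegI.adjoint v := by module
  rw [h2, ContinuousLinearMap.map_add, ContinuousLinearMap.map_smul] at h
  change A.resolventAtNegI.adjoint v - A.resolventAtNegI v =
    (2 * Complex.I) • A.resolventAtNegI (A.resolventAtNegI.adjoint v)
  rw [sub_eq_iff_eq_add', h]

theorem star_cayley (A : H →ₗ.[ℂ] H) :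
    star A.cayley = 1 + (2 * Complex.I) • A.resolventAtNegI.adjoint := by
  rw [cayley, star_sub, star_one, star_smul, ContinuousLinearMap.star_eq_adjoint]
  simp

theorem cayley_mem_unitary (hA : IsSelfAdjoint A) : A.cayley ∈ unitary (H →L[ℂ] H) := by
  have h1 := adjoint_resolventAtNegI_sub hA
  have h2 := adjoint_resolventAtNegI_sub' hA
  set c : ℂ := 2 * Complex.I
  have key (X Y : H →L[ℂ] H) :
      (1 + c • X) * (1 - c • Y) = 1 + c • ((X - Y) - c • (X * Y)) := by
    simp only [mul_sub, add_mul, mul_one, one_mul, smul_mul_smul_comm]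
    module
  have key' (X Y : H →L[ℂ] H) :
      (1 - c • Y) * (1 + c • X) = 1 + c • ((X - Y) - c • (Y * X)) := by
    simp only [mul_add, sub_mul, mul_one, one_mul, smul_mul_smul_comm]
    module
  rw [Unitary.mem_iff, star_cayley, cayley, key, key', ← h1, ← h2]
  simp

theorem isStarNormal_cayley (hA : IsSelfAdjoint A) : IsStarNormal A.cayley :=
  isStarNormal_of_mem_unitary (cayley_mem_unitary hA)

end SelfAdjoint

/-! ### Intertwining operators, from graphs to the continuous functional calculus. -/

section Intertwines

variable {H K : Type*} [NormedAddCommGroup H] [InnerProductSpace ℂ H]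
  [NormedAddCommGroup K] [InnerProductSpace ℂ K]

/-- The bounded operator `V` intertwines `B` with `A`: it maps `Dom B` into `Dom A` and
`A V = V B` on `Dom B`. -/
def Intertwines (B : K →ₗ.[ℂ] K) (A : H →ₗ.[ℂ] H) (V : K →L[ℂ] H) : Prop :=
  ∀ x y : K, (x, y) ∈ B.graph → (V x, V y) ∈ A.graph

variable [CompleteSpace H] [CompleteSpace K]
  {A : H →ₗ.[ℂ] H} {B : K →ₗ.[ℂ] K} {V : K →L[ℂ] H}

theorem Intertwines.resolventAtNegI (hV : Intertwines B A V) (hA : IsSelfAdjoint A)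
    (hB : IsSelfAdjoint B) :
    A.resolventAtNegI ∘L V = V ∘L B.resolventAtNegI := by
  ext v
  have h := resolventAtNegI_apply hA (hV _ _ (resolventAtNegI_mem_graph hB v))
  simpa using h

theorem Intertwines.adjoint_resolventAtNegI (hV : Intertwines B A V) (hA : IsSelfAdjoint A)
    (hB : IsSelfAdjoint B) :
    A.resolventAtNegI.adjoint ∘L V = V ∘L B.resolventAtNegI.adjoint := by
  ext v
  have h := adjoint_resolventAtNegI_apply hA (hV _ _ (adjoint_resolventAtNegI_mem_graph hB v))
  simpa using h

theorem Intertwines.cayley (hV : Intertwines B A V) (hA : IsSelfAdjoint A)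
    (hB : IsSelfAdjoint B) : A.cayley ∘L V = V ∘L B.cayley := by
  ext v
  have h := DFunLike.congr_fun (hV.resolventAtNegI hA hB) v
  simp only [ContinuousLinearMap.comp_apply] at h
  simp [LinearPMap.cayley, h]

theorem Intertwines.star_cayley (hV : Intertwines B A V) (hA : IsSelfAdjoint A)
    (hB : IsSelfAdjoint B) : star A.cayley ∘L V = V ∘L star B.cayley := by
  ext v
  have h := DFunLike.congr_fun (hV.adjoint_resolventAtNegI hA hB) v
  simp only [ContinuousLinearMap.comp_apply] at h
  simp [LinearPMap.star_cayley, h]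

/-- A bounded operator that commutes with the resolvent intertwines the operator with itself. -/
theorem intertwines_of_commute_resolventAtNegI {P : H →L[ℂ] H} (hA : IsSelfAdjoint A)
    (h : ∀ v, P (A.resolventAtNegI v) = A.resolventAtNegI (P v)) : Intertwines A A P := by
  intro x y hxy
  have h1 := resolventAtNegI_mem_graph hA (P (y + Complex.I • x))
  rw [← h, resolventAtNegI_apply hA hxy] at h1
  simpa using h1

end Intertwines

end LinearPMap

/-- The continuous functional calculus of unitary operators respects intertwining operators. -/
theorem cfc_comp_eq_comp_cfc_of_unitary {H K : Type*} [NormedAddCommGroup H]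
    [InnerProductSpace ℂ H] [CompleteSpace H] [NormedAddCommGroup K] [InnerProductSpace ℂ K]
    [CompleteSpace K] {a : H →L[ℂ] H} {b : K →L[ℂ] K} {V : K →L[ℂ] H}
    (ha : a ∈ unitary (H →L[ℂ] H)) (hb : b ∈ unitary (K →L[ℂ] K))
    (h : a ∘L V = V ∘L b) (h' : star a ∘L V = V ∘L star b) {g : ℂ → ℂ}
    (hg : ContinuousOn g (Metric.sphere 0 1)) :
    cfc g a ∘L V = V ∘L cfc g b := by
  have hna : IsStarNormal a := isStarNormal_of_mem_unitary ha
  have hnb : IsStarNormal b := isStarNormal_of_mem_unitary hb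
  have hsa : spectrum ℂ a ⊆ Metric.sphere 0 1 := spectrum.subset_circle_of_unitary ha
  have hsb : spectrum ℂ b ⊆ Metric.sphere 0 1 := spectrum.subset_circle_of_unitary hb
  have : CompactSpace (Metric.sphere (0 : ℂ) 1) :=
    isCompact_iff_compactSpace.1 (isCompact_sphere 0 1)
  -- The two spectra may differ, so both calculi are pulled back to the whole circle, where one
  -- function acts on both sides.
  let ia : C(spectrum ℂ a, Metric.sphere (0 : ℂ) 1) :=
    ⟨Set.inclusion hsa, continuous_inclusion hsa⟩
  let ib : C(spectrum ℂ b, Metric.sphere (0 : ℂ) 1) :=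
    ⟨Set.inclusion hsb, continuous_inclusion hsb⟩
  let φ : C(Metric.sphere (0 : ℂ) 1, ℂ) →⋆ₐ[ℂ] (H →L[ℂ] H) :=
    (cfcHom hna).comp (ContinuousMap.compStarAlgHom' ℂ ℂ ia)
  let ψ : C(Metric.sphere (0 : ℂ) 1, ℂ) →⋆ₐ[ℂ] (K →L[ℂ] K) :=
    (cfcHom hnb).comp (ContinuousMap.compStarAlgHom' ℂ ℂ ib)
  have hφ : Continuous φ := (cfcHom_continuous hna).comp (ContinuousMap.continuous_precomp ia)
  have hψ : Continuous ψ := (cfcHom_continuous hnb).comp (ContinuousMap.continuous_precomp ib)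
  have hφid : φ (.restrict _ (.id ℂ)) = a := cfcHom_id hna
  have hψid : ψ (.restrict _ (.id ℂ)) = b := cfcHom_id hnb
  have key (f : C(Metric.sphere (0 : ℂ) 1, ℂ)) : φ f ∘L V = V ∘L ψ f := by
    induction f using ContinuousMap.induction_on_of_compact with
    | const r =>
      have h1 : φ (.const _ r) = algebraMap ℂ _ r := AlgHomClass.commutes φ r
      have h2 : ψ (.const _ r) = algebraMap ℂ _ r := AlgHomClass.commutes ψ r
      rw [h1, h2]
      ext v
      simp [Algebra.algebraMap_eq_smul_one]
    | id => rw [hφid, hψid, h]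
    | star_id => rw [map_star, map_star, hφid, hψid, h']
    | add f g hf hg =>
      rw [map_add, map_add, ContinuousLinearMap.add_comp, ContinuousLinearMap.comp_add, hf, hg]
    | mul f g hf hg =>
      rw [map_mul, map_mul]
      change φ f ∘L φ g ∘L V = (V ∘L ψ f) ∘L ψ g
      rw [hg, ← hf]
      rfl
    | frequently f hf =>
      exact hf.mem_of_closed (isClosed_eq (by fun_prop) (by fun_prop))
  have h1 := key ⟨fun z => g z, continuousOn_iff_continuous_domRestrict.1 hg⟩
  rw [cfc_apply g a hna (hg.mono hsa), cfc_apply g b hnb (hg.mono hsb)]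
  exact h1

/-! ### Transport of functions from the line to the circle. -/

namespace LinearPMap

theorem onCircle_mul (f g : ℝ → ℂ) : onCircle (fun x => f x * g x) =
    fun z => onCircle f z * onCircle g z := by
  ext z; by_cases h : z = 1 <;> simp [onCircle, h]

theorem onCircle_sub (f g : ℝ → ℂ) : onCircle (fun x => f x - g x) =
    fun z => onCircle f z - onCircle g z := by
  ext z; by_cases h : z = 1 <;> simp [onCircle, h]

theorem onCircle_star (f : ℝ → ℂ) : onCircle (fun x => star (f x)) =
    fun z => star (onCircle f z) := by
  ext z; by_cases h : z = 1 <;> simp [onCircle, h]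

theorem norm_onCircle_le {f : ℝ → ℂ} {C : ℝ} (hC : 0 ≤ C) (h : ∀ x, ‖f x‖ ≤ C) (z : ℂ) :
    ‖onCircle f z‖ ≤ C := by
  by_cases hz : z = 1 <;> simp [onCircle, hz, hC, h]

/-- On the unit circle the inverse Cayley map is real valued. -/
theorem inverseCayley_ofReal_re {z : ℂ} (hz : ‖z‖ = 1) :
    (((Complex.I * (1 + z) / (1 - z)).re : ℝ) : ℂ) = Complex.I * (1 + z) / (1 - z) := by
  by_cases h1 : z = 1
  · simp [h1]
  have h0 : z ≠ 0 := by rintro rfl; simp at hz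
  rw [← Complex.conj_eq_iff_re]
  have hconj : (starRingEnd ℂ) z = z⁻¹ := by
    rw [Complex.inv_def, Complex.normSq_eq_norm_sq, hz]; simp
  have h2 : 1 - z ≠ 0 := sub_ne_zero.2 (Ne.symm h1)
  have h3 : 1 - z⁻¹ ≠ 0 := by
    intro h
    apply h1
    have : z⁻¹ = 1 := by linear_combination -h
    simpa using this
  have h4 : (starRingEnd ℂ) (1 + z) = 1 + z⁻¹ := by
    rw [← hconj, RingHom.map_add, RingHom.map_one]
  have h5 : (starRingEnd ℂ) (1 - z) = 1 - z⁻¹ := by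
    rw [← hconj, RingHom.map_sub, RingHom.map_one]
  rw [map_div₀, map_mul, h4, h5, Complex.conj_I]
  rw [div_eq_div_iff h3 h2]
  field_simp
  ring

/-- In the circle variable the function `(x + i)⁻¹` is affine; this matches the resolvent with the
functional calculus and controls the behaviour near `z = 1`. -/
theorem inverseCayley_add_I_inv {z : ℂ} (hz : ‖z‖ = 1) (h1 : z ≠ 1) :
    ((((Complex.I * (1 + z) / (1 - z)).re : ℝ) : ℂ) + Complex.I)⁻¹ =
      (1 - z) / (2 * Complex.I) := by
  rw [inverseCayley_ofReal_re hz]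
  have h2 : 1 - z ≠ 0 := sub_ne_zero.2 (Ne.symm h1)
  have h3 : Complex.I * (1 + z) / (1 - z) + Complex.I = 2 * Complex.I / (1 - z) := by
    field_simp; ring
  rw [h3, inv_div]

theorem tendsto_inverseCayley :
    Tendsto (fun z : ℂ => (Complex.I * (1 + z) / (1 - z)).re)
      (𝓝[Metric.sphere 0 1 \ {1}] 1) (cocompact ℝ) := by
  have h1 : Tendsto (fun z : ℂ => (1 - z) / (2 * Complex.I)) (𝓝[Metric.sphere 0 1 \ {1}] 1)
      (𝓝[≠] 0) := by
    refine tendsto_nhdsWithin_iff.2 ⟨?_, ?_⟩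
    · have : Tendsto (fun z : ℂ => (1 - z) / (2 * Complex.I)) (𝓝 1)
        (𝓝 ((1 - 1) / (2 * Complex.I))) := by
        refine Continuous.tendsto ?_ 1
        fun_prop
      rw [sub_self, zero_div] at this
      exact this.mono_left nhdsWithin_le_nhds
    · filter_upwards [self_mem_nhdsWithin] with z hz
      have h2 : (1 : ℂ) - z ≠ 0 := sub_ne_zero.2 (Ne.symm hz.2)
      exact div_ne_zero h2 (by simp)
  have h2 := (tendsto_norm_cobounded_atTop (E := ℂ)).comp (tendsto_inv₀_nhdsNE_zero.comp h1)
  rw [← Metric.cobounded_eq_cocompact, ← tendsto_norm_atTop_iff_cobounded]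
  refine tendsto_atTop_mono' _ ?_ (tendsto_atTop_add_const_right _ (-1) h2)
  filter_upwards [self_mem_nhdsWithin] with z hz
  have hz1 : ‖z‖ = 1 := by simpa using hz.1
  have h3 := inverseCayley_add_I_inv hz1 hz.2
  simp only [Function.comp_apply]
  rw [← h3, inv_inv]
  refine (add_le_add_left (norm_add_le _ _) _).trans ?_
  simp

/-- A continuous function vanishing at infinity corresponds to a continuous function on the
unit circle. -/
theorem continuousOn_onCircle {f : ℝ → ℂ} (hf : Continuous f) (h0 : Tendsto f (cocompact ℝ) (𝓝 0)) :
    ContinuousOn (onCircle f) (Metric.sphere 0 1) := by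
  intro z hz
  by_cases h1 : z = 1
  · subst h1
    -- The value `0` assigned at `z = 1` is the limit of `f` at infinity, so only the punctured
    -- circle has to be examined.
    rw [← continuousWithinAt_sdiff_self]
    have hv : onCircle f 1 = 0 := by simp [onCircle]
    rw [ContinuousWithinAt, hv]
    refine (h0.comp tendsto_inverseCayley).congr' ?_
    filter_upwards [self_mem_nhdsWithin] with w hw
    have : w ≠ 1 := hw.2
    simp [onCircle, this]
  · refine ContinuousAt.continuousWithinAt ?_
    have h2 : 1 - z ≠ 0 := sub_ne_zero.2 (Ne.symm h1)
    have h3 : ContinuousAt (fun w : ℂ => f (Complex.I * (1 + w) / (1 - w)).re) z := by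
      refine hf.continuousAt.comp (Complex.continuous_re.continuousAt.comp ?_)
      fun_prop (disch := assumption)
    refine h3.congr ?_
    filter_upwards [isOpen_ne.mem_nhds h1] with w hw
    have : w ≠ 1 := hw
    simp [onCircle, this]

end LinearPMap

/-! ### Scalar estimates for the resolvent function and the cutoffs. -/

namespace LinearPMap

section Scalar

/-- The function `x ↦ (x + i)⁻¹`. -/
def resolventFun (x : ℝ) : ℂ := ((x : ℂ) + Complex.I)⁻¹

theorem ofReal_add_I_ne_zero (x : ℝ) : (x : ℂ) + Complex.I ≠ 0 := by
  intro h
  simpa using congrArg Complex.im h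

theorem continuous_resolventFun : Continuous resolventFun :=
  Continuous.inv₀ (by fun_prop) ofReal_add_I_ne_zero

theorem norm_resolventFun_le (x : ℝ) : ‖resolventFun x‖ ≤ 2 / (|x| + 1) := by
  have h1 : 1 ≤ ‖(x : ℂ) + Complex.I‖ := by
    simpa using Complex.abs_im_le_norm ((x : ℂ) + Complex.I)
  have h2 : |x| ≤ ‖(x : ℂ) + Complex.I‖ := by
    simpa using Complex.abs_re_le_norm ((x : ℂ) + Complex.I)
  rw [resolventFun, norm_inv, inv_eq_one_div, div_le_div_iff₀ (by linarith) (by positivity)]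
  linarith

theorem tendsto_resolventFun : Tendsto resolventFun (cocompact ℝ) (𝓝 0) := by
  refine squeeze_zero_norm norm_resolventFun_le ?_
  refine Tendsto.const_div_atTop ?_ _
  refine tendsto_atTop_add_const_right _ _ ?_
  exact tendsto_norm_cocompact_atTop (E := ℝ)

theorem continuous_cutoff (n : ℕ) : Continuous (cutoff n) := by
  unfold cutoff; fun_prop

theorem cutoff_nonneg (n : ℕ) (x : ℝ) : 0 ≤ cutoff n x := le_max_left _ _

theorem cutoff_le_one (n : ℕ) (x : ℝ) : cutoff n x ≤ 1 := max_le zero_le_one (min_le_left _ _)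

theorem cutoff_eq_one {n : ℕ} {x : ℝ} (h : |x| ≤ n) : cutoff n x = 1 := by
  rw [cutoff, min_eq_left (by linarith), max_eq_right zero_le_one]

theorem cutoff_eq_zero {n : ℕ} {x : ℝ} (h : n + 1 ≤ |x|) : cutoff n x = 0 :=
  max_eq_left ((min_le_right _ _).trans (by linarith))

theorem hasCompactSupport_cutoff (n : ℕ) : HasCompactSupport (cutoff n) := by
  refine HasCompactSupport.intro (isCompact_Icc (a := -(n + 1 : ℝ)) (b := n + 1)) fun x hx => ?_
  refine cutoff_eq_zero ?_
  by_contra h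
  exact hx (abs_le.1 (not_le.1 h).le)

/-- The product of the cutoff function and a continuous function, as a compactly supported
continuous function. -/
def cutoffMul (e : ℝ → ℂ) (he : Continuous e) (n : ℕ) : C_c(ℝ, ℂ) where
  toFun := fun x => (cutoff n x : ℂ) * e x
  continuous_toFun := (Complex.continuous_ofReal.comp (continuous_cutoff n)).mul he
  hasCompactSupport' := by
    refine HasCompactSupport.mul_right ?_
    exact (hasCompactSupport_cutoff n).comp_left (g := fun x : ℝ => (x : ℂ)) Complex.ofReal_zero

theorem norm_cutoffMul_le {e : ℝ → ℂ} {he : Continuous e} (h1 : ∀ x, ‖e x‖ ≤ 1) (n : ℕ) (x : ℝ) :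
    ‖cutoffMul e he n x‖ ≤ 1 := by
  change ‖(cutoff n x : ℂ) * e x‖ ≤ 1
  rw [norm_mul, Complex.norm_real, Real.norm_of_nonneg (cutoff_nonneg n x)]
  exact mul_le_one₀ (cutoff_le_one n x) (norm_nonneg _) (h1 x)

/-- Cutoffs need not converge uniformly, but multiplied by the resolvent function they do: the error
lives on `|x| > n`, where that function is at most `2 / (n + 1)`. -/
theorem norm_cutoffMul_mul_resolventFun_sub_le {e : ℝ → ℂ} {he : Continuous e}
    (h1 : ∀ x, ‖e x‖ ≤ 1) (n : ℕ) (x : ℝ) :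
    ‖cutoffMul e he n x * resolventFun x - e x * resolventFun x‖ ≤ 2 / (n + 1) := by
  change ‖(cutoff n x : ℂ) * e x * resolventFun x - e x * resolventFun x‖ ≤ _
  by_cases hx : |x| ≤ n
  · simp only [cutoff_eq_one hx, Complex.ofReal_one, one_mul, sub_self, norm_zero]
    positivity
  · have h2 : (cutoff n x : ℂ) * e x * resolventFun x - e x * resolventFun x =
        ((cutoff n x - 1 : ℝ) : ℂ) * e x * resolventFun x := by push_cast; ring
    have h3 : |cutoff n x - 1| ≤ 1 :=
      abs_le.2 ⟨by linarith [cutoff_nonneg n x], by linarith [cutoff_le_one n x]⟩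
    rw [h2, norm_mul, norm_mul, Complex.norm_real, Real.norm_eq_abs]
    calc |cutoff n x - 1| * ‖e x‖ * ‖resolventFun x‖ ≤ 1 * ‖resolventFun x‖ :=
          mul_le_mul_of_nonneg_right (mul_le_one₀ h3 (norm_nonneg _) (h1 x)) (norm_nonneg _)
      _ ≤ 2 / (|x| + 1) := by rw [one_mul]; exact norm_resolventFun_le x
      _ ≤ 2 / (n + 1) := by
          have := (not_le.1 hx).le
          gcongr

end Scalar

/-! ### Functional calculus of an unbounded operator and its unitary group. -/

section FunctionalCalculus

variable {H : Type*} [NormedAddCommGroup H] [InnerProductSpace ℂ H] [CompleteSpace H]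
  {A : H →ₗ.[ℂ] H}

theorem spectrum_cayley_subset (hA : IsSelfAdjoint A) :
    spectrum ℂ A.cayley ⊆ Metric.sphere 0 1 :=
  spectrum.subset_circle_of_unitary (cayley_mem_unitary hA)

theorem continuousOn_onCircle_spectrum (hA : IsSelfAdjoint A) {f : ℝ → ℂ} (hf : Continuous f)
    (h0 : Tendsto f (cocompact ℝ) (𝓝 0)) : ContinuousOn (onCircle f) (spectrum ℂ A.cayley) :=
  (continuousOn_onCircle hf h0).mono (spectrum_cayley_subset hA)

theorem applyFun_resolventFun (hA : IsSelfAdjoint A) :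
    A.applyFun resolventFun = A.resolventAtNegI := by
  have := isStarNormal_cayley hA
  have h1 : A.applyFun resolventFun =
      cfc (fun z : ℂ => (2 * Complex.I)⁻¹ * (1 - z)) A.cayley := by
    refine cfc_congr fun z hz => ?_
    have hz1 : ‖z‖ = 1 := by simpa using spectrum_cayley_subset hA hz
    by_cases h1 : z = 1
    · simp [onCircle, h1]
    · simp only [onCircle, h1, if_false, resolventFun]
      rw [inverseCayley_add_I_inv hz1 h1]
      ring
  rw [h1, cfc_const_mul _ _ _, cfc_sub _ _ _, cfc_const_one _ _, cfc_id' _ _, cayley,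
    sub_sub_cancel, smul_smul, inv_mul_cancel₀ (by simp), one_smul]

theorem applyFun_mul (hA : IsSelfAdjoint A) {f g : ℝ → ℂ} (hf : Continuous f)
    (hf0 : Tendsto f (cocompact ℝ) (𝓝 0)) (hg : Continuous g)
    (hg0 : Tendsto g (cocompact ℝ) (𝓝 0)) :
    A.applyFun (fun x => f x * g x) = A.applyFun f * A.applyFun g := by
  rw [applyFun, onCircle_mul, cfc_mul _ _ _ (continuousOn_onCircle_spectrum hA hf hf0)
    (continuousOn_onCircle_spectrum hA hg hg0)]
  rfl

theorem applyFun_sub (hA : IsSelfAdjoint A) {f g : ℝ → ℂ} (hf : Continuous f)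
    (hf0 : Tendsto f (cocompact ℝ) (𝓝 0)) (hg : Continuous g)
    (hg0 : Tendsto g (cocompact ℝ) (𝓝 0)) :
    A.applyFun (fun x => f x - g x) = A.applyFun f - A.applyFun g := by
  rw [applyFun, onCircle_sub, cfc_sub _ _ _ (continuousOn_onCircle_spectrum hA hf hf0)
    (continuousOn_onCircle_spectrum hA hg hg0)]
  rfl

theorem applyFun_star (A : H →ₗ.[ℂ] H) (f : ℝ → ℂ) :
    A.applyFun (fun x => star (f x)) = (A.applyFun f).adjoint := by
  rw [applyFun, onCircle_star, cfc_star]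
  rfl

theorem norm_applyFun_le (A : H →ₗ.[ℂ] H) {f : ℝ → ℂ} {C : ℝ} (hC : 0 ≤ C)
    (h : ∀ x, ‖f x‖ ≤ C) : ‖A.applyFun f‖ ≤ C :=
  norm_cfc_le hC fun z _ => norm_onCircle_le hC h z

theorem tendsto_cocompact_zero (f : C_c(ℝ, ℂ)) : Tendsto f (cocompact ℝ) (𝓝 0) :=
  f.hasCompactSupport.is_zero_at_infty

/-- The resolvent has dense range. -/
theorem denseRange_resolventAtNegI (hA : IsSelfAdjoint A) : DenseRange A.resolventAtNegI := by
  refine hA.dense_domain.mono fun x hx => ?_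
  exact ⟨_, resolventAtNegI_apply hA (A.mem_graph ⟨x, hx⟩)⟩

theorem tendsto_applyFun_cutoffMul_resolvent (hA : IsSelfAdjoint A) {e : ℝ → ℂ}
    (he : Continuous e) (h1 : ∀ x, ‖e x‖ ≤ 1) (u : H) :
    Tendsto (fun n : ℕ => A.applyFun (cutoffMul e he n) (A.resolventAtNegI u)) atTop
      (𝓝 (A.applyFun (fun x => e x * resolventFun x) u)) := by
  have hb0 : Tendsto (fun x => e x * resolventFun x) (cocompact ℝ) (𝓝 0) := by
    refine squeeze_zero_norm (fun x => ?_) (tendsto_zero_iff_norm_tendsto_zero.1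
      tendsto_resolventFun)
    rw [norm_mul]
    exact mul_le_of_le_one_left (norm_nonneg _) (h1 x)
  have hbc : Continuous fun x => e x * resolventFun x := he.mul continuous_resolventFun
  have hkey (n : ℕ) : ‖A.applyFun (cutoffMul e he n) (A.resolventAtNegI u) -
      A.applyFun (fun x => e x * resolventFun x) u‖ ≤ 2 / ((n : ℝ) + 1) * ‖u‖ := by
    have hcc : Continuous (cutoffMul e he n) := (cutoffMul e he n).continuous
    have hc0 := tendsto_cocompact_zero (cutoffMul e he n)
    have hb1 : Tendsto (fun x => cutoffMul e he n x * resolventFun x) (cocompact ℝ) (𝓝 0) := by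
      have := hc0.mul tendsto_resolventFun
      rwa [mul_zero] at this
    have hbc1 : Continuous fun x => cutoffMul e he n x * resolventFun x :=
      hcc.mul continuous_resolventFun
    have h2 : A.applyFun (fun x => cutoffMul e he n x * resolventFun x - e x * resolventFun x) =
        A.applyFun (cutoffMul e he n) * A.resolventAtNegI -
          A.applyFun (fun x => e x * resolventFun x) := by
      rw [applyFun_sub hA hbc1 hb1 hbc hb0,
        applyFun_mul hA hcc hc0 continuous_resolventFun tendsto_resolventFun,
        applyFun_resolventFun hA]
    have h3 := norm_applyFun_le A (C := 2 / ((n : ℝ) + 1)) (by positivity)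
      (norm_cutoffMul_mul_resolventFun_sub_le (he := he) h1 n)
    rw [h2] at h3
    exact ContinuousLinearMap.le_of_opNorm_le _ h3 u
  rw [tendsto_iff_norm_sub_tendsto_zero]
  refine squeeze_zero (fun _ => norm_nonneg _) hkey ?_
  have h4 : Tendsto (fun n : ℕ => 2 * (1 / ((n : ℝ) + 1)) * ‖u‖) atTop (𝓝 (2 * 0 * ‖u‖)) :=
    (tendsto_one_div_add_atTop_nhds_zero_nat.const_mul 2).mul_const _
  simpa only [mul_one_div, mul_zero, zero_mul] using h4

theorem norm_applyFun_cutoffMul_le (A : H →ₗ.[ℂ] H) {e : ℝ → ℂ} (he : Continuous e)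
    (h1 : ∀ x, ‖e x‖ ≤ 1) (n : ℕ) (v : H) : ‖A.applyFun (cutoffMul e he n) v‖ ≤ ‖v‖ := by
  have h := ContinuousLinearMap.le_of_opNorm_le _
    (norm_applyFun_le A zero_le_one (norm_cutoffMul_le (he := he) h1 n)) v
  rwa [one_mul] at h

/-- The operators are contractions and converge on the dense range of the resolvent; a three-epsilon
argument extends this to every vector. -/
theorem cauchySeq_applyFun_cutoffMul (hA : IsSelfAdjoint A) {e : ℝ → ℂ}
    (he : Continuous e) (h1 : ∀ x, ‖e x‖ ≤ 1) (v : H) :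
    CauchySeq fun n : ℕ => A.applyFun (cutoffMul e he n) v := by
  rw [Metric.cauchySeq_iff']
  intro ε hε
  obtain ⟨u, hu⟩ := (denseRange_resolventAtNegI hA).exists_dist_lt v (show 0 < ε / 3 by positivity)
  obtain ⟨N, hN⟩ := Metric.cauchySeq_iff'.1
    (tendsto_applyFun_cutoffMul_resolvent hA he h1 u).cauchySeq (ε / 3) (by positivity)
  refine ⟨N, fun n hn => ?_⟩
  have h2 := hN n hn
  have h3 (m : ℕ) : dist (A.applyFun (cutoffMul e he m) v)
      (A.applyFun (cutoffMul e he m) (A.resolventAtNegI u)) < ε / 3 := by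
    rw [dist_eq_norm, ← ContinuousLinearMap.map_sub]
    refine (norm_applyFun_cutoffMul_le A he h1 m _).trans_lt ?_
    rwa [← dist_eq_norm]
  have h4 := h3 N
  rw [dist_comm] at h4
  have h5 := dist_triangle4 (A.applyFun (cutoffMul e he n) v)
    (A.applyFun (cutoffMul e he n) (A.resolventAtNegI u))
    (A.applyFun (cutoffMul e he N) (A.resolventAtNegI u)) (A.applyFun (cutoffMul e he N) v)
  linarith [h3 n]

/-- An approximate identity by compactly supported functions: the limit is the identity on the dense
range of the resolvent, hence everywhere. It puts a set inside its own orbit and gives `exp(0) = 1`.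
-/
theorem tendsto_applyFun_cutoffMul_one (hA : IsSelfAdjoint A) (v : H) :
    Tendsto (fun n : ℕ => A.applyFun (cutoffMul (fun _ => 1) continuous_const n) v) atTop
      (𝓝 v) := by
  have h1 : ∀ x : ℝ, ‖(fun _ : ℝ => (1 : ℂ)) x‖ ≤ 1 := by simp
  obtain ⟨w, hw⟩ := cauchySeq_tendsto_of_complete
    (cauchySeq_applyFun_cutoffMul hA continuous_const h1 v)
  suffices w = v by rwa [this] at hw
  refine eq_of_forall_dist_le fun ε hε => ?_
  obtain ⟨u, hu⟩ := (denseRange_resolventAtNegI hA).exists_dist_lt v (show 0 < ε / 2 by positivity)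
  have h2 := tendsto_applyFun_cutoffMul_resolvent hA continuous_const h1 u
  simp only [one_mul] at h2
  rw [show (fun x => resolventFun x) = resolventFun from rfl, applyFun_resolventFun hA] at h2
  have h3 : dist w (A.resolventAtNegI u) ≤ ε / 2 := by
    refine le_of_tendsto (hw.dist h2) (Eventually.of_forall fun n => ?_)
    rw [dist_eq_norm, ← ContinuousLinearMap.map_sub]
    refine (norm_applyFun_cutoffMul_le A continuous_const h1 n _).trans ?_
    rw [← dist_eq_norm]
    exact hu.le
  have h4 := dist_triangle w (A.resolventAtNegI u) v
  rw [dist_comm (A.resolventAtNegI u) v] at h4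
  linarith

theorem tendsto_expNegI (hA : IsSelfAdjoint A) (t : ℝ) (v : H) :
    Tendsto (fun n : ℕ => A.applyFun
      (fun x => (cutoff n x : ℂ) * Complex.exp (-(Complex.I * t * x))) v) atTop
      (𝓝 (A.expNegI t v)) := by
  have hex : ∃ T : H →L[ℂ] H, ∀ v : H, Tendsto
      (fun n : ℕ => A.applyFun
        (fun x => (cutoff n x : ℂ) * Complex.exp (-(Complex.I * t * x))) v) atTop (𝓝 (T v)) := by
    have he : Continuous fun x : ℝ => Complex.exp (-(Complex.I * t * x)) := by fun_prop
    have h1 (x : ℝ) : ‖Complex.exp (-(Complex.I * t * x))‖ ≤ 1 := by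
      rw [Complex.norm_exp]
      simp
    choose T hT using fun v => cauchySeq_tendsto_of_complete
      (cauchySeq_applyFun_cutoffMul hA he h1 v)
    -- The pointwise limit is bounded by Banach–Steinhaus, so `expNegI` never takes its default
    -- value `0` here.
    exact ⟨continuousLinearMapOfTendsto _ (tendsto_pi_nhds.2 hT), hT⟩
  rw [expNegI, dif_pos hex]
  exact hex.choose_spec v

theorem expNegI_zero (hA : IsSelfAdjoint A) : A.expNegI 0 = 1 := by
  ext v
  have h := tendsto_expNegI hA 0 v
  simp only [Complex.ofReal_zero, mul_zero, zero_mul, neg_zero, Complex.exp_zero] at h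
  exact tendsto_nhds_unique h (tendsto_applyFun_cutoffMul_one hA v)

variable {K : Type*} [NormedAddCommGroup K] [InnerProductSpace ℂ K] [CompleteSpace K]
  {B : K →ₗ.[ℂ] K} {V : K →L[ℂ] H}

/-- `V` need not be isometric: the lemma serves both inclusions of subspaces and orthogonal
projections. -/
theorem Intertwines.applyFun (hV : Intertwines B A V) (hA : IsSelfAdjoint A)
    (hB : IsSelfAdjoint B) {f : ℝ → ℂ} (hf : Continuous f)
    (h0 : Tendsto f (cocompact ℝ) (𝓝 0)) (v : K) :
    A.applyFun f (V v) = V (B.applyFun f v) :=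
  DFunLike.congr_fun (cfc_comp_eq_comp_cfc_of_unitary (cayley_mem_unitary hA)
    (cayley_mem_unitary hB) (hV.cayley hA hB) (hV.star_cayley hA hB)
    (continuousOn_onCircle hf h0)) v

theorem Intertwines.expNegI (hV : Intertwines B A V) (hA : IsSelfAdjoint A)
    (hB : IsSelfAdjoint B) (t : ℝ) (v : K) : A.expNegI t (V v) = V (B.expNegI t v) := by
  refine tendsto_nhds_unique (tendsto_expNegI hA t (V v)) ?_
  have h := (V.continuous.tendsto _).comp (tendsto_expNegI hB t v)
  refine h.congr fun n => ?_
  have he : Continuous fun x : ℝ => Complex.exp (-(Complex.I * t * x)) := by fun_prop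
  exact (hV.applyFun hA hB (cutoffMul _ he n).continuous
    (tendsto_cocompact_zero (cutoffMul _ he n)) v).symm

end FunctionalCalculus

end LinearPMap

/-! ### Orbits, invariant subspaces and restrictions. -/

namespace LinearPMap

/-- Valid for every closed `K`, because the domain of the restriction includes the condition `A v ∈
K`. -/
theorem mem_graph_restrictTo {H : Type*} [NormedAddCommGroup H] [InnerProductSpace ℂ H]
    {A : H →ₗ.[ℂ] H} {K : ClosedSubmodule ℂ H} {x y : K.toSubmodule} :
    (x, y) ∈ (A.restrictTo K).graph ↔ ((x : H), (y : H)) ∈ A.graph := by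
  rw [mem_graph_iff, mem_graph_iff]
  constructor
  · rintro ⟨⟨u, hu⟩, rfl, rfl⟩
    exact ⟨⟨u, hu.choose⟩, rfl, rfl⟩
  · rintro ⟨⟨u, hu⟩, h1, h2⟩
    change u = x at h1
    subst h1
    change _ = (y : H) at h2
    exact ⟨⟨x, hu, h2 ▸ y.2⟩, rfl, Subtype.ext h2⟩

theorem intertwines_subtypeL {H : Type*} [NormedAddCommGroup H] [InnerProductSpace ℂ H]
    {A : H →ₗ.[ℂ] H} {K : ClosedSubmodule ℂ H} :
    Intertwines (A.restrictTo K) A K.toSubmodule.subtypeL :=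
  fun _ _ h => mem_graph_restrictTo.1 h

variable {H : Type*} [NormedAddCommGroup H] [InnerProductSpace ℂ H] [CompleteSpace H]
  {A : H →ₗ.[ℂ] H} {S : Set H} {K : ClosedSubmodule ℂ H}

theorem orbit_le_iff : A.orbit S ≤ K ↔ ∀ (f : C_c(ℝ, ℂ)), ∀ w ∈ S, A.applyFun f w ∈ K := by
  rw [orbit, Submodule.closure_le, Submodule.span_le]
  constructor
  · intro h f w hw
    exact h ⟨f, w, hw, rfl⟩
  · rintro h _ ⟨f, w, hw, rfl⟩
    exact h f w hw

theorem applyFun_mem_orbit (f : C_c(ℝ, ℂ)) {w : H} (hw : w ∈ S) : A.applyFun f w ∈ A.orbit S :=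
  orbit_le_iff.1 le_rfl f w hw

theorem orbit_le_of_isInvariant (hK : A.IsInvariant K) (h : ∀ v ∈ S, v ∈ K) : A.orbit S ≤ K := by
  rw [orbit_le_iff]
  intro f w hw
  rw [← hK]
  exact applyFun_mem_orbit f (h w hw)

theorem subset_orbit (hA : IsSelfAdjoint A) {v : H} (hv : v ∈ S) : v ∈ A.orbit S :=
  (A.orbit S).isClosed.mem_of_tendsto (tendsto_applyFun_cutoffMul_one hA v)
    (Eventually.of_forall fun _ => applyFun_mem_orbit _ hv)

/-- If `f` has compact support so does `r * f`, so `r(A)` sends generators of the orbit to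
generators. This allows `r` to be the resolvent function, whose support is not compact. -/
theorem applyFun_mul_mem_orbit (hA : IsSelfAdjoint A) {r : ℝ → ℂ} (hr : Continuous r)
    (hr0 : Tendsto r (cocompact ℝ) (𝓝 0)) {v : H} (hv : v ∈ A.orbit S) :
    A.applyFun r v ∈ A.orbit S := by
  suffices A.orbit S ≤ (A.orbit S).comap (A.applyFun r) from this hv
  rw [orbit_le_iff]
  intro f w hw
  rw [ClosedSubmodule.mem_comap]
  have hf : Continuous f := f.continuous
  let g : C_c(ℝ, ℂ) := ⟨⟨fun x => r x * f x, hr.mul hf⟩, f.hasCompactSupport.mul_left⟩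
  have h : A.applyFun g = A.applyFun r * A.applyFun f :=
    applyFun_mul hA hr hr0 hf (tendsto_cocompact_zero f)
  have h2 : A.applyFun r (A.applyFun f w) = A.applyFun g w := by rw [h]; rfl
  rw [h2]
  exact applyFun_mem_orbit g hw

theorem resolventAtNegI_mem_orbit (hA : IsSelfAdjoint A) {v : H} (hv : v ∈ A.orbit S) :
    A.resolventAtNegI v ∈ A.orbit S := by
  rw [← applyFun_resolventFun hA]
  exact applyFun_mul_mem_orbit hA continuous_resolventFun tendsto_resolventFun hv

theorem adjoint_resolventAtNegI_mem_orbit (hA : IsSelfAdjoint A) {v : H} (hv : v ∈ A.orbit S) :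
    A.resolventAtNegI.adjoint v ∈ A.orbit S := by
  rw [← applyFun_resolventFun hA, ← applyFun_star]
  refine applyFun_mul_mem_orbit hA continuous_resolventFun.star ?_ hv
  simpa using tendsto_resolventFun.star

/-- Stability under the adjoint makes `Kᗮ` stable under the resolvent, so the resolvent is block
diagonal and commutes with the projection. -/
theorem intertwines_starProjection_of_resolvent (hA : IsSelfAdjoint A)
    (h1 : ∀ v ∈ K, A.resolventAtNegI v ∈ K) (h2 : ∀ v ∈ K, A.resolventAtNegI.adjoint v ∈ K) :
    Intertwines A A K.toSubmodule.starProjection := by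
  refine intertwines_of_commute_resolventAtNegI hA fun v => ?_
  refine (Submodule.eq_starProjection_of_mem_of_inner_eq_zero
    (h1 _ (K.toSubmodule.starProjection_apply_mem v)) fun w hw => ?_)
  rw [← ContinuousLinearMap.map_sub, ← ContinuousLinearMap.adjoint_inner_right]
  exact K.toSubmodule.starProjection_inner_eq_zero v _ (h2 w hw)

/-- A closed subspace is invariant iff its orthogonal projection commutes with the operator. -/
theorem isInvariant_iff (hA : IsSelfAdjoint A) :
    A.IsInvariant K ↔ Intertwines A A K.toSubmodule.starProjection := by
  constructor
  · intro h
    refine intertwines_starProjection_of_resolvent hA (fun v hv => ?_) fun v hv => ?_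
    · rw [← h] at hv ⊢
      exact resolventAtNegI_mem_orbit hA hv
    · rw [← h] at hv ⊢
      exact adjoint_resolventAtNegI_mem_orbit hA hv
  · intro h
    refine le_antisymm (orbit_le_iff.2 fun f w hw => ?_) fun v hv => subset_orbit hA hv
    rw [← Submodule.starProjection_eq_self_iff.2 hw, h.applyFun hA hA (f := f) f.continuous
      (tendsto_cocompact_zero f)]
    exact K.toSubmodule.starProjection_apply_mem _

theorem isInvariant_orbit (hA : IsSelfAdjoint A) (S : Set H) : A.IsInvariant (A.orbit S) :=
  (isInvariant_iff hA).2 (intertwines_starProjection_of_resolvent hA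
    (fun _ => resolventAtNegI_mem_orbit hA) fun _ => adjoint_resolventAtNegI_mem_orbit hA)

theorem IsInvariant.orthogonal (hK : A.IsInvariant K) (hA : IsSelfAdjoint A) :
    A.IsInvariant K.orthogonal := by
  rw [isInvariant_iff hA] at hK ⊢
  intro x y hxy
  have h := A.graph.sub_mem hxy (hK x y hxy)
  change (K.toSubmoduleᗮ.starProjection x, K.toSubmoduleᗮ.starProjection y) ∈ A.graph
  rwa [Submodule.starProjection_orthogonal_val, Submodule.starProjection_orthogonal_val]

theorem isInvariant_top (hA : IsSelfAdjoint A) : A.IsInvariant ⊤ :=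
  le_antisymm (fun _ _ => ClosedSubmodule.mem_top) fun _ hv => subset_orbit hA hv

theorem isInvariant_bot (hA : IsSelfAdjoint A) : A.IsInvariant ⊥ := by
  refine le_antisymm (orbit_le_iff.2 fun f w hw => ?_) fun _ hv => subset_orbit hA hv
  have : w = 0 := hw
  rw [this, ContinuousLinearMap.map_zero]
  exact ClosedSubmodule.mem_bot.2 rfl

theorem IsInvariant.isSelfAdjoint_restrictTo (hK : A.IsInvariant K) (hA : IsSelfAdjoint A) :
    IsSelfAdjoint (A.restrictTo K) := by
  have hP := (isInvariant_iff hA).1 hK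
  rw [isSelfAdjoint_iff_graph]
  refine ⟨?_, fun x w => ?_⟩
  -- The projection of the dense domain of `A` is dense in `K` and, by invariance, stays in the
  -- domain.
  · let p : H → K.toSubmodule := fun v => ⟨K.toSubmodule.starProjection v,
      K.toSubmodule.starProjection_apply_mem v⟩
    have hp : Continuous p := K.toSubmodule.starProjection.continuous.subtype_mk _
    have hs : Function.Surjective p := fun v =>
      ⟨v, Subtype.ext (Submodule.starProjection_eq_self_iff.2 v.2)⟩
    refine (hs.denseRange.dense_image hp hA.dense_domain).mono ?_
    rintro _ ⟨v, hv, rfl⟩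
    have h := hP _ _ (A.mem_graph ⟨v, hv⟩)
    exact mem_domain_of_mem_graph (y := p (A ⟨v, hv⟩)) (mem_graph_restrictTo.2 h)
  · rw [mem_graph_restrictTo]
    constructor
    · intro h y z hyz
      exact inner_eq_of_mem_graph hA h (mem_graph_restrictTo.1 hyz)
    · intro h
      -- A test pair of `A` is replaced by its projection to `K`; inner products with vectors of `K`
      -- do not change.
      refine mem_graph_of_inner hA fun y z hyz => ?_
      have h1 := h ⟨_, K.toSubmodule.starProjection_apply_mem y⟩
        ⟨_, K.toSubmodule.starProjection_apply_mem z⟩ (mem_graph_restrictTo.2 (hP y z hyz))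
      change inner ℂ (K.toSubmodule.starProjection z) (x : H) =
        inner ℂ (K.toSubmodule.starProjection y) (w : H) at h1
      rwa [Submodule.inner_starProjection_left_eq_right,
        Submodule.inner_starProjection_left_eq_right,
        Submodule.starProjection_eq_self_iff.2 x.2, Submodule.starProjection_eq_self_iff.2 w.2] at h1

/-- The orbit of a set under the restriction of an operator is the orbit under the operator. -/
theorem mem_orbit_restrictTo (hK : A.IsInvariant K) (hA : IsSelfAdjoint A)
    {S : Set K.toSubmodule} {v : K.toSubmodule} :
    v ∈ (A.restrictTo K).orbit S ↔ (v : H) ∈ A.orbit (Subtype.val '' S) := by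
  have hB := hK.isSelfAdjoint_restrictTo hA
  have happ (f : C_c(ℝ, ℂ)) (w : K.toSubmodule) :
      A.applyFun f (w : H) = ((A.restrictTo K).applyFun f w : K.toSubmodule) :=
    intertwines_subtypeL.applyFun hA hB f.continuous (tendsto_cocompact_zero f) w
  constructor
  · intro hv
    suffices (A.restrictTo K).orbit S ≤
        (A.orbit (Subtype.val '' S)).comap K.toSubmodule.subtypeL from this hv
    rw [orbit_le_iff]
    intro f w hw
    rw [ClosedSubmodule.mem_comap, Submodule.subtypeL_apply, ← happ]
    exact applyFun_mem_orbit f ⟨w, hw, rfl⟩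
  · intro hv
    -- The restricted orbit, seen in `H`, is still closed because `K` is.
    let L : ClosedSubmodule ℂ H :=
      { toSubmodule := ((A.restrictTo K).orbit S).toSubmodule.map K.toSubmodule.subtype
        isClosed' := K.isClosed.isClosedEmbedding_subtypeVal.isClosedMap _
          ((A.restrictTo K).orbit S).isClosed }
    have hL : A.orbit (Subtype.val '' S) ≤ L := by
      rw [orbit_le_iff]
      rintro f _ ⟨w, hw, rfl⟩
      exact ⟨_, applyFun_mem_orbit f hw, (happ f w).symm⟩
    obtain ⟨u, hu, huv⟩ := hL hv
    rwa [← Subtype.ext huv]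

end LinearPMap

/-! ### The block operator, invariant direct sums and friction functions. -/

namespace CoupledSystem

open LinearPMap

variable {H₁ H₂ : Type*} [NormedAddCommGroup H₁] [InnerProductSpace ℂ H₁]
  [NormedAddCommGroup H₂] [InnerProductSpace ℂ H₂]

theorem mem_directSum {K₁ : ClosedSubmodule ℂ H₁} {K₂ : ClosedSubmodule ℂ H₂}
    {x : WithLp 2 (H₁ × H₂)} : x ∈ directSum K₁ K₂ ↔ x.fst ∈ K₁ ∧ x.snd ∈ K₂ := Iff.rfl

theorem directSum_le_iff {K₁ L₁ : ClosedSubmodule ℂ H₁} {K₂ L₂ : ClosedSubmodule ℂ H₂} :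
    directSum K₁ K₂ ≤ directSum L₁ L₂ ↔ K₁ ≤ L₁ ∧ K₂ ≤ L₂ := by
  constructor
  · intro h
    refine ⟨fun v hv => ?_, fun v hv => ?_⟩
    · exact (h (show WithLp.toLp 2 (v, (0 : H₂)) ∈ directSum K₁ K₂ from
        ⟨hv, K₂.toSubmodule.zero_mem⟩)).1
    · exact (h (show WithLp.toLp 2 ((0 : H₁), v) ∈ directSum K₁ K₂ from
        ⟨K₁.toSubmodule.zero_mem, hv⟩)).2
  · rintro ⟨h1, h2⟩ x hx
    exact ⟨h1 hx.1, h2 hx.2⟩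

variable [CompleteSpace H₁] [CompleteSpace H₂]

theorem starProjection_directSum (K₁ : ClosedSubmodule ℂ H₁) (K₂ : ClosedSubmodule ℂ H₂)
    (x : WithLp 2 (H₁ × H₂)) :
    (directSum K₁ K₂).toSubmodule.starProjection x =
      WithLp.toLp 2 (K₁.toSubmodule.starProjection x.fst, K₂.toSubmodule.starProjection x.snd) := by
  refine Submodule.eq_starProjection_of_mem_of_inner_eq_zero
    ⟨K₁.toSubmodule.starProjection_apply_mem _, K₂.toSubmodule.starProjection_apply_mem _⟩
    fun w hw => ?_
  rw [WithLp.prod_inner_apply]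
  have h1 := K₁.toSubmodule.starProjection_inner_eq_zero x.fst w.fst hw.1
  have h2 := K₂.toSubmodule.starProjection_inner_eq_zero x.snd w.snd hw.2
  exact (congrArg₂ (· + ·) h1 h2).trans (add_zero 0)

variable (S : CoupledSystem H₁ H₂)

theorem mem_graph_Ω {x y : WithLp 2 (H₁ × H₂)} : (x, y) ∈ S.Ω.graph ↔
    (x.fst, y.fst - S.Γ x.snd) ∈ S.Ω₁.graph ∧ (x.snd, y.snd - S.Γ.adjoint x.fst) ∈ S.Ω₂.graph := by
  simp only [mem_graph_iff]
  constructor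
  · rintro ⟨⟨u, hu⟩, rfl, rfl⟩
    refine ⟨⟨⟨_, hu.1⟩, rfl, ?_⟩, ⟨⟨_, hu.2⟩, rfl, ?_⟩⟩
    · exact (add_sub_cancel_right _ _).symm
    · exact (add_sub_cancel_left _ _).symm
  · rintro ⟨⟨⟨u, hu⟩, h1, h2⟩, ⟨⟨v, hv⟩, h3, h4⟩⟩
    change u = x.fst at h1
    change v = x.snd at h3
    subst h1 h3
    refine ⟨⟨x, hu, hv⟩, rfl, ?_⟩
    change WithLp.toLp 2 (S.Ω₁ ⟨x.fst, hu⟩ + S.Γ x.snd, S.Γ.adjoint x.fst + S.Ω₂ ⟨x.snd, hv⟩) = y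
    change S.Ω₁ ⟨x.fst, hu⟩ = _ at h2
    change S.Ω₂ ⟨x.snd, hv⟩ = _ at h4
    rw [h2, h4, sub_add_cancel, add_sub_cancel]
    rfl

variable {S}

theorem isSelfAdjoint_Ω (hS : S.IsConservative) : IsSelfAdjoint S.Ω := by
  obtain ⟨h1, h2⟩ := hS
  rw [isSelfAdjoint_iff_graph]
  -- Test pairs supported in one component split the adjoint relation for `Ω` into those for `Ω₁`
  -- and `Ω₂`; the bounded off-diagonal part is symmetric.
  have hinl {y z : H₁} (h : (y, z) ∈ S.Ω₁.graph) :
      (WithLp.toLp 2 (y, (0 : H₂)), WithLp.toLp 2 (z, S.Γ.adjoint y)) ∈ S.Ω.graph := by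
    rw [mem_graph_Ω]
    simpa using h
  have hinr {y z : H₂} (h : (y, z) ∈ S.Ω₂.graph) :
      (WithLp.toLp 2 ((0 : H₁), y), WithLp.toLp 2 (S.Γ y, z)) ∈ S.Ω.graph := by
    rw [mem_graph_Ω]
    simpa using h
  refine ⟨?_, fun x w => ⟨fun h y z hyz => ?_, fun h => ?_⟩⟩
  · rw [← Submodule.dense_iff_topologicalClosure_eq_top.symm,
      Submodule.topologicalClosure_eq_top_iff, Submodule.eq_bot_iff]
    intro x hx
    rw [Submodule.mem_orthogonal] at hx
    have hx1 : x.fst = 0 := h1.dense_domain.eq_zero_of_inner_right ℂ fun v hv => by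
      have := hx _ (mem_domain_of_mem_graph (hinl (S.Ω₁.mem_graph ⟨v, hv⟩)))
      rw [WithLp.prod_inner_apply] at this
      simpa using this
    have hx2 : x.snd = 0 := h2.dense_domain.eq_zero_of_inner_right ℂ fun v hv => by
      have := hx _ (mem_domain_of_mem_graph (hinr (S.Ω₂.mem_graph ⟨v, hv⟩)))
      rw [WithLp.prod_inner_apply] at this
      simpa using this
    exact (WithLp.ofLp_injective 2) (Prod.ext hx1 hx2)
  · rw [mem_graph_Ω] at h hyz
    have e1 := inner_eq_of_mem_graph h1 h.1 hyz.1
    have e2 := inner_eq_of_mem_graph h2 h.2 hyz.2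
    rw [inner_sub_left, inner_sub_right, ← ContinuousLinearMap.adjoint_inner_right] at e1
    rw [inner_sub_left, inner_sub_right, ContinuousLinearMap.adjoint_inner_left,
      ContinuousLinearMap.adjoint_inner_right] at e2
    rw [ContinuousLinearMap.adjoint_inner_right] at e1
    rw [WithLp.prod_inner_apply, WithLp.prod_inner_apply]
    change inner ℂ z.fst x.fst + inner ℂ z.snd x.snd = inner ℂ y.fst w.fst + inner ℂ y.snd w.snd
    linear_combination e1 + e2
  · rw [mem_graph_Ω]
    constructor
    · refine mem_graph_of_inner h1 fun y z hyz => ?_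
      have e := h _ _ (hinl hyz)
      rw [WithLp.prod_inner_apply, WithLp.prod_inner_apply] at e
      change inner ℂ z x.fst + inner ℂ (S.Γ.adjoint y) x.snd =
        inner ℂ y w.fst + inner ℂ (0 : H₂) w.snd at e
      rw [inner_zero_left, ContinuousLinearMap.adjoint_inner_left] at e
      rw [inner_sub_right]
      linear_combination e
    · refine mem_graph_of_inner h2 fun y z hyz => ?_
      have e := h _ _ (hinr hyz)
      rw [WithLp.prod_inner_apply, WithLp.prod_inner_apply] at e
      change inner ℂ (S.Γ y) x.fst + inner ℂ z x.snd =
        inner ℂ (0 : H₁) w.fst + inner ℂ y w.snd at e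
      rw [inner_zero_left] at e
      rw [inner_sub_right, ContinuousLinearMap.adjoint_inner_right]
      linear_combination e

theorem swap_isConservative (hS : S.IsConservative) : S.swap.IsConservative := ⟨hS.2, hS.1⟩

@[simp] theorem adjoint_swap_Γ : S.swap.Γ.adjoint = S.Γ :=
  ContinuousLinearMap.adjoint_adjoint _

theorem swap_a₁ (t : ℝ) : S.swap.a₁ t = S.a₂ t := by
  rw [a₁, adjoint_swap_Γ]; rfl

theorem swap_openSystem₁ : S.swap.openSystem₁ = S.openSystem₂ :=
  congrArg (OpenSystem.mk S.Ω₂) (funext swap_a₁)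

theorem inner_Γ_left (S : CoupledSystem H₁ H₂) (x : H₂) (y : H₁) :
    inner ℂ (S.Γ x) y = inner ℂ x (S.Γ.adjoint y) :=
  (ContinuousLinearMap.adjoint_inner_right _ _ _).symm

variable {K₁ : ClosedSubmodule ℂ H₁} {K₂ : ClosedSubmodule ℂ H₂}

/-- A direct sum is invariant under `Ω` iff its summands are invariant under `Ω₁` and `Ω₂` and the
coupling maps them into each other. -/
theorem isInvariant_directSum_iff (hS : S.IsConservative) :
    S.Ω.IsInvariant (directSum K₁ K₂) ↔ S.Ω₁.IsInvariant K₁ ∧ S.Ω₂.IsInvariant K₂ ∧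
      (∀ v ∈ K₂, S.Γ v ∈ K₁) ∧ ∀ v ∈ K₁, S.Γ.adjoint v ∈ K₂ := by
  rw [isInvariant_iff (isSelfAdjoint_Ω hS), isInvariant_iff hS.1, isInvariant_iff hS.2]
  constructor
  · intro h
    have hl {y z : H₁} (hyz : (y, z) ∈ S.Ω₁.graph) :
        (K₁.toSubmodule.starProjection y, K₁.toSubmodule.starProjection z) ∈ S.Ω₁.graph ∧
          K₂.toSubmodule.starProjection (S.Γ.adjoint y) =
            S.Γ.adjoint (K₁.toSubmodule.starProjection y) := by
      have h1 := h (WithLp.toLp 2 (y, (0 : H₂))) (WithLp.toLp 2 (z, S.Γ.adjoint y))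
        (by rw [mem_graph_Ω]; simpa using hyz)
      rw [starProjection_directSum, starProjection_directSum, mem_graph_Ω] at h1
      simp only [WithLp.toLp_fst, WithLp.toLp_snd, ContinuousLinearMap.map_zero, sub_zero] at h1
      -- The second component is a graph pair of `Ω₂` over `0`, so its value, the commutator of `Γ†`
      -- with the projections, is zero.
      exact ⟨h1.1, sub_eq_zero.1 (graph_fst_eq_zero_snd _ h1.2 rfl)⟩
    have hr {y z : H₂} (hyz : (y, z) ∈ S.Ω₂.graph) :
        (K₂.toSubmodule.starProjection y, K₂.toSubmodule.starProjection z) ∈ S.Ω₂.graph ∧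
          K₁.toSubmodule.starProjection (S.Γ y) =
            S.Γ (K₂.toSubmodule.starProjection y) := by
      have h1 := h (WithLp.toLp 2 ((0 : H₁), y)) (WithLp.toLp 2 (S.Γ y, z))
        (by rw [mem_graph_Ω]; simpa using hyz)
      rw [starProjection_directSum, starProjection_directSum, mem_graph_Ω] at h1
      simp only [WithLp.toLp_fst, WithLp.toLp_snd, ContinuousLinearMap.map_zero, sub_zero] at h1
      exact ⟨h1.2, sub_eq_zero.1 (graph_fst_eq_zero_snd _ h1.1 rfl)⟩
    -- The commutation holds on a dense domain and extends to all vectors by boundedness.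
    have hl' : ⇑(K₂.toSubmodule.starProjection ∘L S.Γ.adjoint) =
        S.Γ.adjoint ∘L K₁.toSubmodule.starProjection :=
      Continuous.ext_on hS.1.dense_domain (ContinuousLinearMap.continuous _)
        (ContinuousLinearMap.continuous _) fun y hy => (hl (S.Ω₁.mem_graph ⟨y, hy⟩)).2
    have hr' : ⇑(K₁.toSubmodule.starProjection ∘L S.Γ) =
        S.Γ ∘L K₂.toSubmodule.starProjection :=
      Continuous.ext_on hS.2.dense_domain (ContinuousLinearMap.continuous _)
        (ContinuousLinearMap.continuous _) fun y hy => (hr (S.Ω₂.mem_graph ⟨y, hy⟩)).2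
    refine ⟨fun y z hyz => (hl hyz).1, fun y z hyz => (hr hyz).1, fun v hv => ?_, fun v hv => ?_⟩
    · refine Submodule.starProjection_eq_self_iff.1 ((congrFun hr' v).trans ?_)
      exact congrArg S.Γ (Submodule.starProjection_eq_self_iff.2 hv)
    · refine Submodule.starProjection_eq_self_iff.1 ((congrFun hl' v).trans ?_)
      exact congrArg S.Γ.adjoint (Submodule.starProjection_eq_self_iff.2 hv)
  · rintro ⟨h1, h2, h3, h4⟩ x y hxy
    -- Both mapping conditions enter: one puts `Γ P₂ v` in `K₁`, the other makes the remainder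
    -- orthogonal to `K₁`.
    have hr (v : H₂) : K₁.toSubmodule.starProjection (S.Γ v) =
        S.Γ (K₂.toSubmodule.starProjection v) := by
      refine Submodule.eq_starProjection_of_mem_of_inner_eq_zero
        (h3 _ (K₂.toSubmodule.starProjection_apply_mem v)) fun w hw => ?_
      rw [← ContinuousLinearMap.map_sub, inner_Γ_left]
      exact K₂.toSubmodule.starProjection_inner_eq_zero v _ (h4 w hw)
    have hl (v : H₁) : K₂.toSubmodule.starProjection (S.Γ.adjoint v) =
        S.Γ.adjoint (K₁.toSubmodule.starProjection v) := by
      refine Submodule.eq_starProjection_of_mem_of_inner_eq_zero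
        (h4 _ (K₁.toSubmodule.starProjection_apply_mem v)) fun w hw => ?_
      rw [← ContinuousLinearMap.map_sub, ContinuousLinearMap.adjoint_inner_left]
      exact K₁.toSubmodule.starProjection_inner_eq_zero v _ (h3 w hw)
    rw [mem_graph_Ω] at hxy
    rw [starProjection_directSum, starProjection_directSum, mem_graph_Ω]
    have e1 := h1 _ _ hxy.1
    have e2 := h2 _ _ hxy.2
    rw [ContinuousLinearMap.map_sub, hr] at e1
    rw [ContinuousLinearMap.map_sub, hl] at e2
    exact ⟨e1, e2⟩

theorem isInvariant_directSum_swap (hS : S.IsConservative)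
    (h : S.Ω.IsInvariant (directSum K₁ K₂)) : S.swap.Ω.IsInvariant (directSum K₂ K₁) := by
  rw [isInvariant_directSum_iff hS] at h
  rw [isInvariant_directSum_iff (swap_isConservative hS), adjoint_swap_Γ]
  exact ⟨h.2.1, h.1, h.2.2.2, h.2.2.1⟩

/-- If `K` contains the range of `Γ`, then `Γ†` is determined by its values on `K`. -/
theorem adjoint_Γ_starProjection (h : ∀ w, S.Γ w ∈ K₁) (v : H₁) :
    S.Γ.adjoint (K₁.toSubmodule.starProjection v) = S.Γ.adjoint v := by
  refine ext_inner_left ℂ fun w => ?_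
  rw [← inner_Γ_left, ← inner_Γ_left, ← Submodule.inner_starProjection_left_eq_right,
    Submodule.starProjection_eq_self_iff.2 (h w)]

theorem adjoint_Γ_eq_zero (h : ∀ w, S.Γ w ∈ K₁) {v : H₁} (hv : v ∈ K₁.toSubmoduleᗮ) :
    S.Γ.adjoint v = 0 := by
  refine ext_inner_left ℂ fun w => ?_
  rw [← inner_Γ_left, inner_zero_right]
  exact (Submodule.mem_orthogonal _ _).1 hv _ (h w)

/-- `Γ†` factors through the projection onto `K₁`, so knowing it on `K₁` is enough. This makes
condition (c), which mentions only `Ran Γ`, symmetric in the two components. -/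
theorem adjoint_Γ_mem_of_Γ_mem (h : ∀ w, S.Γ w ∈ K₁) (h' : ∀ v ∈ K₁, S.Γ.adjoint v ∈ K₂)
    (v : H₁) : S.Γ.adjoint v ∈ K₂ := by
  rw [← adjoint_Γ_starProjection h]
  exact h' _ (K₁.toSubmodule.starProjection_apply_mem v)

/-- If `Γ†` vanishes on the orthogonal complement of `K`, then `K` contains the range of `Γ`. -/
theorem Γ_mem_of_adjoint_Γ_eq_zero (h : ∀ v ∈ K₁.toSubmoduleᗮ, S.Γ.adjoint v = 0) (w : H₂) :
    S.Γ w ∈ K₁ := by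
  rw [← ClosedSubmodule.mem_toSubmodule_iff, ← K₁.toSubmodule.orthogonal_orthogonal,
    Submodule.mem_orthogonal']
  intro u hu
  rw [inner_Γ_left, h u hu, inner_zero_right]

/-- The projection coming from the compression disappears once `Γ` maps `K₂` into `K₁`. -/
theorem subsystem_Γ {H₁ H₂ : Type*} [NormedAddCommGroup H₁] [InnerProductSpace ℂ H₁]
    [CompleteSpace H₁] [NormedAddCommGroup H₂] [InnerProductSpace ℂ H₂]
    {S : CoupledSystem H₁ H₂} {K₁ : ClosedSubmodule ℂ H₁} {K₂ : ClosedSubmodule ℂ H₂}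
    (v : K₂.toSubmodule) :
    (((S.subsystem K₁ K₂).Γ v : K₁.toSubmodule) : H₁) =
      K₁.toSubmodule.starProjection (S.Γ v) := by
  simp only [subsystem, Submodule.adjoint_subtypeL]
  rfl

theorem swap_subsystem : (S.subsystem K₁ K₂).swap = S.swap.subsystem K₂ K₁ := by
  simp only [subsystem, swap, ContinuousLinearMap.adjoint_comp,
    ContinuousLinearMap.adjoint_adjoint]
  rfl

theorem subsystem_adjoint_Γ (v : K₁.toSubmodule) :
    (((S.subsystem K₁ K₂).Γ.adjoint v : K₂.toSubmodule) : H₂) =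
      K₂.toSubmodule.starProjection (S.Γ.adjoint v) := by
  have h := subsystem_Γ (S := S.swap) (K₁ := K₂) (K₂ := K₁) v
  rwa [← swap_subsystem] at h

theorem subsystem_isConservative (hS : S.IsConservative) (h₁ : S.Ω₁.IsInvariant K₁)
    (h₂ : S.Ω₂.IsInvariant K₂) : (S.subsystem K₁ K₂).IsConservative :=
  ⟨h₁.isSelfAdjoint_restrictTo hS.1, h₂.isSelfAdjoint_restrictTo hS.2⟩

/-- The friction function of the restriction of a system to an invariant direct sum is the
restriction of the friction function. -/
theorem a₁_eq_subsystem_a₁ (hS : S.IsConservative) (h : S.Ω.IsInvariant (directSum K₁ K₂))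
    (t : ℝ) (v : K₁.toSubmodule) :
    S.a₁ t v = ((S.subsystem K₁ K₂).a₁ t v : K₁.toSubmodule) := by
  obtain ⟨-, h2, h3, h4⟩ := (isInvariant_directSum_iff hS).1 h
  have e1 : S.Γ.adjoint v = ((S.subsystem K₁ K₂).Γ.adjoint v : K₂.toSubmodule) := by
    rw [subsystem_adjoint_Γ, Submodule.starProjection_eq_self_iff.2 (h4 v v.2)]
  have e2 (u : K₂.toSubmodule) : S.Γ u = ((S.subsystem K₁ K₂).Γ u : K₁.toSubmodule) := by
    rw [subsystem_Γ, Submodule.starProjection_eq_self_iff.2 (h3 u u.2)]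
  change S.Γ (S.Ω₂.expNegI t (S.Γ.adjoint v)) = ((S.subsystem K₁ K₂).Γ
    ((S.Ω₂.restrictTo K₂).expNegI t ((S.subsystem K₁ K₂).Γ.adjoint v)) : K₁.toSubmodule)
  rw [e1, ← e2]
  exact congrArg S.Γ
    (intertwines_subtypeL.expNegI hS.2 (h2.isSelfAdjoint_restrictTo hS.2) t _)

theorem a₂_eq_subsystem_a₂ (hS : S.IsConservative) (h : S.Ω.IsInvariant (directSum K₁ K₂))
    (t : ℝ) (v : K₂.toSubmodule) :
    S.a₂ t v = ((S.subsystem K₁ K₂).a₂ t v : K₂.toSubmodule) := by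
  rw [← swap_a₁, ← swap_a₁, swap_subsystem]
  exact a₁_eq_subsystem_a₁ (swap_isConservative hS) (isInvariant_directSum_swap hS h) t v

theorem a₁_eq_zero (h : ∀ w, S.Γ w ∈ K₁) {v : H₁} (hv : v ∈ K₁.toSubmoduleᗮ) (t : ℝ) :
    S.a₁ t v = 0 := by
  change S.Γ (S.Ω₂.expNegI t (S.Γ.adjoint v)) = 0
  rw [adjoint_Γ_eq_zero h hv, ContinuousLinearMap.map_zero, ContinuousLinearMap.map_zero]

theorem a₂_eq_zero (h : ∀ w, S.Γ.adjoint w ∈ K₂) {v : H₂} (hv : v ∈ K₂.toSubmoduleᗮ) (t : ℝ) :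
    S.a₂ t v = 0 := by
  rw [← swap_a₁]
  exact a₁_eq_zero (S := S.swap) h hv t

end CoupledSystem

/-! ### Reconstructibility, minimal extensions and the orbits of the coupling ranges. -/

namespace CoupledSystem

open LinearPMap

variable {H₁ H₂ : Type*} [NormedAddCommGroup H₁] [InnerProductSpace ℂ H₁] [CompleteSpace H₁]
  [NormedAddCommGroup H₂] [InnerProductSpace ℂ H₂] [CompleteSpace H₂]
  {S : CoupledSystem H₁ H₂} {K₁ : ClosedSubmodule ℂ H₁} {K₂ : ClosedSubmodule ℂ H₂}

/-- A conservative system extends its own open systems by definition, so only the two orbit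
conditions remain. -/
theorem isReconstructible_iff (hS : S.IsConservative) : S.IsReconstructible ↔
    S.Ω₂.orbit (Set.range S.Γ.adjoint) = ⊤ ∧ S.Ω₁.orbit (Set.range S.Γ) = ⊤ := by
  rw [IsReconstructible, IsMinimalConservativeExtension, IsMinimalConservativeExtension,
    adjoint_swap_Γ]
  constructor
  · rintro ⟨⟨-, -, -, h⟩, -, -, -, h'⟩
    exact ⟨h, h'⟩
  · rintro ⟨h, h'⟩
    exact ⟨⟨hS, rfl, fun _ _ => rfl, h⟩, swap_isConservative hS, rfl, fun t _ => swap_a₁ t, h'⟩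

/-- `g` stands for the restricted adjoint coupling, with domain `K₁` in the subsystem and `H₁` when
only the second component is cut down. -/
theorem orbit_range_adjoint_restrict_eq_top_iff (hS : S.IsConservative)
    (h : S.Ω₂.IsInvariant K₂) {G : Type*} {g : G → K₂.toSubmodule}
    (hg : Subtype.val '' Set.range g = Set.range S.Γ.adjoint) :
    (S.Ω₂.restrictTo K₂).orbit (Set.range g) = ⊤ ↔
      K₂ ≤ S.Ω₂.orbit (Set.range S.Γ.adjoint) := by
  constructor
  · intro h1 v hv
    have h2 : (⟨v, hv⟩ : K₂.toSubmodule) ∈ (S.Ω₂.restrictTo K₂).orbit (Set.range g) := by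
      rw [h1]; exact ClosedSubmodule.mem_top
    rwa [mem_orbit_restrictTo h hS.2, hg] at h2
  · intro h1
    refine le_antisymm (fun _ _ => ClosedSubmodule.mem_top) fun v _ => ?_
    rw [mem_orbit_restrictTo h hS.2, hg]
    exact h1 v.2

theorem subsystem_orbit_eq_top (hS : S.IsConservative)
    (h : S.Ω.IsInvariant (directSum K₁ K₂)) (hΓ : ∀ w, S.Γ w ∈ K₁)
    (hle : K₂ ≤ S.Ω₂.orbit (Set.range S.Γ.adjoint)) :
    (S.subsystem K₁ K₂).Ω₂.orbit (Set.range (S.subsystem K₁ K₂).Γ.adjoint) = ⊤ := by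
  obtain ⟨-, h2, -, h4⟩ := (isInvariant_directSum_iff hS).1 h
  refine (orbit_range_adjoint_restrict_eq_top_iff hS h2 ?_).2 hle
  ext u
  constructor
  · rintro ⟨_, ⟨v, rfl⟩, rfl⟩
    rw [subsystem_adjoint_Γ, Submodule.starProjection_eq_self_iff.2 (h4 v v.2)]
    exact ⟨_, rfl⟩
  · rintro ⟨v, rfl⟩
    -- Projecting `v` to `K₁` does not change `Γ† v`, so cutting down the first component loses none
    -- of `Ran Γ†`.
    refine ⟨_, ⟨⟨_, K₁.toSubmodule.starProjection_apply_mem v⟩, rfl⟩, ?_⟩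
    rw [subsystem_adjoint_Γ]
    change K₂.toSubmodule.starProjection
      (S.Γ.adjoint (K₁.toSubmodule.starProjection v)) = S.Γ.adjoint v
    rw [adjoint_Γ_starProjection hΓ,
      Submodule.starProjection_eq_self_iff.2 (adjoint_Γ_mem_of_Γ_mem hΓ h4 v)]

theorem restrictSnd_adjoint_Γ (v : H₁) :
    (((S.restrictSnd K₂).Γ.adjoint v : K₂.toSubmodule) : H₂) =
      K₂.toSubmodule.starProjection (S.Γ.adjoint v) := by
  simp only [restrictSnd, ContinuousLinearMap.adjoint_comp, Submodule.adjoint_subtypeL]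
  rfl

theorem isMinimalConservativeExtension_restrictSnd_iff (hS : S.IsConservative)
    (h : S.Ω₂.IsInvariant K₂) (hΓ : ∀ v, S.Γ.adjoint v ∈ K₂) :
    IsMinimalConservativeExtension S.openSystem₁ (S.restrictSnd K₂) ↔
      K₂ = S.Ω₂.orbit (Set.range S.Γ.adjoint) := by
  have hadj (v : H₁) : (((S.restrictSnd K₂).Γ.adjoint v : K₂.toSubmodule) : H₂) =
      S.Γ.adjoint v := by
    rw [restrictSnd_adjoint_Γ, Submodule.starProjection_eq_self_iff.2 (hΓ v)]
  have hle : S.Ω₂.orbit (Set.range S.Γ.adjoint) ≤ K₂ :=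
    orbit_le_of_isInvariant h (by rintro _ ⟨v, rfl⟩; exact hΓ v)
  have horb : (S.restrictSnd K₂).Ω₂.orbit (Set.range (S.restrictSnd K₂).Γ.adjoint) = ⊤ ↔
      K₂ ≤ S.Ω₂.orbit (Set.range S.Γ.adjoint) := by
    refine orbit_range_adjoint_restrict_eq_top_iff hS h ?_
    rw [← Set.range_comp]
    exact congrArg Set.range (funext hadj)
  rw [IsMinimalConservativeExtension, horb]
  have hsa := h.isSelfAdjoint_restrictTo hS.2
  constructor
  · rintro ⟨-, -, -, h1⟩
    exact le_antisymm h1 hle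
  · intro h1
    refine ⟨⟨hS.1, hsa⟩, rfl, fun t _ => ?_, h1.le⟩
    ext v
    change S.Γ ((S.Ω₂.restrictTo K₂).expNegI t ((S.restrictSnd K₂).Γ.adjoint v) : K₂.toSubmodule) =
      S.Γ (S.Ω₂.expNegI t (S.Γ.adjoint v))
    rw [← hadj]
    exact congrArg S.Γ (intertwines_subtypeL.expNegI hS.2 hsa t _).symm

theorem isInvariant_directSum_top_orbit (hS : S.IsConservative) :
    S.Ω.IsInvariant (directSum ⊤ (S.Ω₂.orbit (Set.range S.Γ.adjoint))) :=
  (isInvariant_directSum_iff hS).2 ⟨isInvariant_top hS.1, isInvariant_orbit hS.2 _,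
    fun _ _ => ClosedSubmodule.mem_top, fun v _ => subset_orbit hS.2 (Set.mem_range_self v)⟩

theorem isInvariant_directSum_orbit_top (hS : S.IsConservative) :
    S.Ω.IsInvariant (directSum (S.Ω₁.orbit (Set.range S.Γ)) ⊤) :=
  (isInvariant_directSum_iff hS).2 ⟨isInvariant_orbit hS.1 _, isInvariant_top hS.2,
    fun v _ => subset_orbit hS.1 (Set.mem_range_self v), fun _ _ => ClosedSubmodule.mem_top⟩

theorem isInvariant_directSum_orbit_orbit (hS : S.IsConservative) :
    S.Ω.IsInvariant (directSum (S.Ω₁.orbit (Set.range S.Γ))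
      (S.Ω₂.orbit (Set.range S.Γ.adjoint))) :=
  (isInvariant_directSum_iff hS).2 ⟨isInvariant_orbit hS.1 _, isInvariant_orbit hS.2 _,
    fun v _ => subset_orbit hS.1 (Set.mem_range_self v),
    fun v _ => subset_orbit hS.2 (Set.mem_range_self v)⟩

theorem isMinimalExtensionWithin₁_iff (hS : S.IsConservative)
    (K : ClosedSubmodule ℂ (WithLp 2 (H₁ × H₂))) : S.IsMinimalExtensionWithin₁ K ↔
      K = directSum ⊤ (S.Ω₂.orbit (Set.range S.Γ.adjoint)) := by
  constructor
  · rintro ⟨h1, K₂, rfl, h2⟩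
    obtain ⟨-, h3, -, h4⟩ := (isInvariant_directSum_iff hS).1 h1
    rw [isMinimalConservativeExtension_restrictSnd_iff hS h3
      fun v => h4 v ClosedSubmodule.mem_top] at h2
    rw [← h2]
  · rintro rfl
    refine ⟨isInvariant_directSum_top_orbit hS, _, rfl, ?_⟩
    exact (isMinimalConservativeExtension_restrictSnd_iff hS (isInvariant_orbit hS.2 _)
      fun v => subset_orbit hS.2 (Set.mem_range_self v)).2 rfl

theorem isMinimalExtensionWithin₂_iff (hS : S.IsConservative)
    (K : ClosedSubmodule ℂ (WithLp 2 (H₁ × H₂))) : S.IsMinimalExtensionWithin₂ K ↔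
      K = directSum (S.Ω₁.orbit (Set.range S.Γ)) ⊤ := by
  have hS' := swap_isConservative hS
  constructor
  · rintro ⟨h1, K₁, rfl, h2⟩
    obtain ⟨h3, -, h4, -⟩ := (isInvariant_directSum_iff hS).1 h1
    rw [← swap_openSystem₁, isMinimalConservativeExtension_restrictSnd_iff hS' h3 (fun v => by
      rw [adjoint_swap_Γ]; exact h4 v ClosedSubmodule.mem_top), adjoint_swap_Γ] at h2
    rw [h2]
    rfl
  · rintro rfl
    refine ⟨isInvariant_directSum_orbit_top hS, _, rfl, ?_⟩
    rw [← swap_openSystem₁, isMinimalConservativeExtension_restrictSnd_iff hS'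
      (isInvariant_orbit hS.1 _) (fun v => by
        rw [adjoint_swap_Γ]; exact subset_orbit hS.1 (Set.mem_range_self v)), adjoint_swap_Γ]
    rfl

/-- A closed subspace containing `H₁` splits automatically as `H₁ ⊕ L₂`. The invariance criterion
then forces `L₂` to contain the orbit of `Ran Γ†`. -/
theorem orbit_fst (hS : S.IsConservative) :
    S.Ω.orbit (directSum (⊤ : ClosedSubmodule ℂ H₁) (⊥ : ClosedSubmodule ℂ H₂) :
      Set (WithLp 2 (H₁ × H₂))) = directSum ⊤ (S.Ω₂.orbit (Set.range S.Γ.adjoint)) := by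
  have hΩ := isSelfAdjoint_Ω hS
  set L := S.Ω.orbit (directSum (⊤ : ClosedSubmodule ℂ H₁) (⊥ : ClosedSubmodule ℂ H₂) :
      Set (WithLp 2 (H₁ × H₂)))
  have hL : S.Ω.IsInvariant L := isInvariant_orbit hΩ _
  have hsub (v : H₁) : WithLp.toLp 2 (v, (0 : H₂)) ∈ L :=
    subset_orbit hΩ (mem_directSum.2
      ⟨ClosedSubmodule.mem_top, (⊥ : ClosedSubmodule ℂ H₂).toSubmodule.zero_mem⟩)
  refine le_antisymm (orbit_le_of_isInvariant (isInvariant_directSum_top_orbit hS)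
    fun v hv => mem_directSum.2 ⟨ClosedSubmodule.mem_top, ?_⟩) ?_
  · rw [ClosedSubmodule.mem_bot.1 (show v.snd ∈ (⊥ : ClosedSubmodule ℂ H₂) from hv.2)]
    exact (S.Ω₂.orbit _).toSubmodule.zero_mem
  · let L₂ : ClosedSubmodule ℂ H₂ := L.comap
      (((WithLp.prodContinuousLinearEquiv 2 ℂ H₁ H₂).symm : H₁ × H₂ →L[ℂ] WithLp 2 (H₁ × H₂)) ∘L
        ContinuousLinearMap.inr ℂ H₁ H₂)
    have hL₂ (v : H₂) : v ∈ L₂ ↔ WithLp.toLp 2 ((0 : H₁), v) ∈ L := Iff.rfl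
    have hsplit (x : WithLp 2 (H₁ × H₂)) :
        x = WithLp.toLp 2 (x.fst, (0 : H₂)) + WithLp.toLp 2 ((0 : H₁), x.snd) := by
      refine WithLp.ofLp_injective 2 (Prod.ext ?_ ?_)
      · exact (add_zero _).symm
      · exact (zero_add _).symm
    have heq : L = directSum ⊤ L₂ := by
      refine SetLike.ext fun x => ?_
      rw [mem_directSum, hL₂]
      constructor
      · intro hx
        refine ⟨ClosedSubmodule.mem_top, ?_⟩
        rw [← sub_eq_iff_eq_add'.2 (hsplit x)]
        exact L.toSubmodule.sub_mem hx (hsub _)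
      · rintro ⟨-, hx⟩
        rw [hsplit x]
        exact L.toSubmodule.add_mem (hsub _) hx
    rw [heq] at hL ⊢
    obtain ⟨-, h2, -, h4⟩ := (isInvariant_directSum_iff hS).1 hL
    refine directSum_le_iff.2 ⟨le_rfl, orbit_le_of_isInvariant h2 ?_⟩
    rintro _ ⟨v, rfl⟩
    exact h4 v ClosedSubmodule.mem_top

theorem orbit_snd (hS : S.IsConservative) :
    S.Ω.orbit (directSum (⊥ : ClosedSubmodule ℂ H₁) (⊤ : ClosedSubmodule ℂ H₂) :
      Set (WithLp 2 (H₁ × H₂))) = directSum (S.Ω₁.orbit (Set.range S.Γ)) ⊤ := by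
  have hΩ := isSelfAdjoint_Ω hS
  set L := S.Ω.orbit (directSum (⊥ : ClosedSubmodule ℂ H₁) (⊤ : ClosedSubmodule ℂ H₂) :
      Set (WithLp 2 (H₁ × H₂)))
  have hL : S.Ω.IsInvariant L := isInvariant_orbit hΩ _
  have hsub (v : H₂) : WithLp.toLp 2 ((0 : H₁), v) ∈ L :=
    subset_orbit hΩ (mem_directSum.2
      ⟨(⊥ : ClosedSubmodule ℂ H₁).toSubmodule.zero_mem, ClosedSubmodule.mem_top⟩)
  refine le_antisymm (orbit_le_of_isInvariant (isInvariant_directSum_orbit_top hS)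
    fun v hv => mem_directSum.2 ⟨?_, ClosedSubmodule.mem_top⟩) ?_
  · rw [ClosedSubmodule.mem_bot.1 (show v.fst ∈ (⊥ : ClosedSubmodule ℂ H₁) from hv.1)]
    exact (S.Ω₁.orbit _).toSubmodule.zero_mem
  · let L₁ : ClosedSubmodule ℂ H₁ := L.comap
      (((WithLp.prodContinuousLinearEquiv 2 ℂ H₁ H₂).symm : H₁ × H₂ →L[ℂ] WithLp 2 (H₁ × H₂)) ∘L
        ContinuousLinearMap.inl ℂ H₁ H₂)
    have hL₁ (v : H₁) : v ∈ L₁ ↔ WithLp.toLp 2 (v, (0 : H₂)) ∈ L := Iff.rfl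
    have hsplit (x : WithLp 2 (H₁ × H₂)) :
        x = WithLp.toLp 2 ((0 : H₁), x.snd) + WithLp.toLp 2 (x.fst, (0 : H₂)) := by
      refine WithLp.ofLp_injective 2 (Prod.ext ?_ ?_)
      · exact (zero_add _).symm
      · exact (add_zero _).symm
    have heq : L = directSum L₁ ⊤ := by
      refine SetLike.ext fun x => ?_
      rw [mem_directSum, hL₁]
      constructor
      · intro hx
        refine ⟨?_, ClosedSubmodule.mem_top⟩
        rw [← sub_eq_iff_eq_add'.2 (hsplit x)]
        exact L.toSubmodule.sub_mem hx (hsub _)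
      · rintro ⟨hx, -⟩
        rw [hsplit x]
        exact L.toSubmodule.add_mem (hsub _) hx
    rw [heq] at hL ⊢
    obtain ⟨h1, -, h3, -⟩ := (isInvariant_directSum_iff hS).1 hL
    refine directSum_le_iff.2 ⟨orbit_le_of_isInvariant h1 ?_, le_rfl⟩
    rintro _ ⟨v, rfl⟩
    exact h3 v ClosedSubmodule.mem_top

/-- The coupled parts form the smallest invariant direct sum that contains `Ran Γ`. -/
theorem isLeast_directSum_orbit (hS : S.IsConservative) :
    IsLeast {K | S.IsSplitInvariantContainingRange K}
      (directSum (S.Ω₁.orbit (Set.range S.Γ)) (S.Ω₂.orbit (Set.range S.Γ.adjoint))) := by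
  refine ⟨⟨isInvariant_directSum_orbit_orbit hS, ⟨_, _, rfl⟩, fun w =>
    ⟨subset_orbit hS.1 (Set.mem_range_self w), (S.Ω₂.orbit _).toSubmodule.zero_mem⟩⟩, ?_⟩
  rintro _ ⟨h, ⟨K₁, K₂, rfl⟩, hΓ⟩
  obtain ⟨h1, h2, -, h4⟩ := (isInvariant_directSum_iff hS).1 h
  have hΓ' (w : H₂) : S.Γ w ∈ K₁ := (hΓ w).1
  refine directSum_le_iff.2 ⟨orbit_le_of_isInvariant h1 ?_, orbit_le_of_isInvariant h2 ?_⟩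
  · rintro _ ⟨w, rfl⟩
    exact hΓ' w
  · rintro _ ⟨v, rfl⟩
    exact adjoint_Γ_mem_of_Γ_mem hΓ' h4 v

/-- Since `a₁(0) = Γ Γ†`, the adjoint coupling `Γ†` vanishes wherever `a₁(0)` does. -/
theorem adjoint_Γ_eq_zero_of_a₁_zero (hS : S.IsConservative) {v : H₁} (h : S.a₁ 0 v = 0) :
    S.Γ.adjoint v = 0 := by
  change S.Γ (S.Ω₂.expNegI 0 (S.Γ.adjoint v)) = 0 at h
  rw [expNegI_zero hS.2] at h
  change S.Γ (S.Γ.adjoint v) = 0 at h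
  -- `‖Γ† v‖² = ⟪v, Γ Γ† v⟫`.
  rw [← inner_self_eq_zero (𝕜 := ℂ), ContinuousLinearMap.adjoint_inner_left, h, inner_zero_right]

/-- The value at `t = 0` suffices: `Γ†` vanishes on `K₁ᗮ`, hence `Ran Γ ⊆ K₁ᗮᗮ = K₁`. -/
theorem Determines₁.Γ_mem (h : S.Determines₁ K₁ K₂) (hS : S.IsConservative) (w : H₂) :
    S.Γ w ∈ K₁ :=
  Γ_mem_of_adjoint_Γ_eq_zero
    (fun v hv => adjoint_Γ_eq_zero_of_a₁_zero hS ((h 0 le_rfl).2 v hv)) w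

theorem Determines₂.adjoint_Γ_mem (h : S.Determines₂ K₁ K₂) (hS : S.IsConservative) (w : H₁) :
    S.Γ.adjoint w ∈ K₂ := by
  refine Γ_mem_of_adjoint_Γ_eq_zero (S := S.swap) (fun v hv => ?_) w
  exact adjoint_Γ_eq_zero_of_a₁_zero (swap_isConservative hS)
    ((congrArg (· v) (swap_a₁ 0)).trans ((h 0 le_rfl).2 v hv))

/-- An invariant direct sum that contains `Ran Γ` contains the coupled parts. -/
theorem directSum_orbit_le (hS : S.IsConservative) (h : S.Ω.IsInvariant (directSum K₁ K₂))
    (hΓ : ∀ w, S.Γ w ∈ K₁) :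
    directSum (S.Ω₁.orbit (Set.range S.Γ)) (S.Ω₂.orbit (Set.range S.Γ.adjoint)) ≤
      directSum K₁ K₂ :=
  (isLeast_directSum_orbit hS).2 ⟨h, ⟨_, _, rfl⟩, fun w => ⟨hΓ w, K₂.toSubmodule.zero_mem⟩⟩

/-- The orbit of `Ran Γ` is the whole space iff no nonzero subspace of `H₁` is invariant. -/
theorem orbit_range_eq_top_iff (hS : S.IsConservative) :
    S.Ω₁.orbit (Set.range S.Γ) = ⊤ ↔
      ∀ K₁ : ClosedSubmodule ℂ H₁, S.Ω.IsInvariant (directSum K₁ ⊥) → K₁ = ⊥ := by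
  have hbot (v : H₂) : v ∈ (⊥ : ClosedSubmodule ℂ H₂) ↔ v = 0 := ClosedSubmodule.mem_bot
  constructor
  · intro htop K₁ h
    obtain ⟨h1, -, -, h4⟩ := (isInvariant_directSum_iff hS).1 h
    -- Invariance of `K₁ ⊕ 0` means that `Γ†` kills `K₁`, so `Ran Γ` is orthogonal to `K₁`, and so
    -- is its orbit.
    have hle : S.Ω₁.orbit (Set.range S.Γ) ≤ K₁.orthogonal := by
      refine orbit_le_of_isInvariant (h1.orthogonal hS.1) ?_
      rintro _ ⟨w, rfl⟩
      refine (Submodule.mem_orthogonal' _ _).2 fun u hu => ?_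
      rw [inner_Γ_left, (hbot _).1 (h4 u hu), inner_zero_right]
    rw [htop] at hle
    refine le_antisymm (fun v hv => ?_) bot_le
    have hv' : v ∈ K₁.toSubmoduleᗮ := hle ClosedSubmodule.mem_top
    exact ClosedSubmodule.mem_bot.2
      (inner_self_eq_zero.1 ((Submodule.mem_orthogonal _ _).1 hv' v hv))
  · intro h
    have hinv := isInvariant_orbit hS.1 (Set.range S.Γ)
    -- The complement of the orbit is invariant and killed by `Γ†`, so it is itself a candidate for
    -- `K₁`.
    have h0 := h (S.Ω₁.orbit (Set.range S.Γ)).orthogonal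
      ((isInvariant_directSum_iff hS).2 ⟨hinv.orthogonal hS.1, isInvariant_bot hS.2,
        fun v hv => by
          rw [(hbot v).1 hv, ContinuousLinearMap.map_zero]
          exact (ClosedSubmodule.orthogonal _).toSubmodule.zero_mem,
        fun v hv => (hbot _).2
          (adjoint_Γ_eq_zero (fun w => subset_orbit hS.1 (Set.mem_range_self w)) hv)⟩)
    have h1 : (S.Ω₁.orbit (Set.range S.Γ)).toSubmoduleᗮ = ⊥ :=
      congrArg ClosedSubmodule.toSubmodule h0
    exact ClosedSubmodule.toSubmodule_injective (Submodule.orthogonal_eq_bot_iff.1 h1)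

theorem orbit_range_adjoint_eq_top_iff (hS : S.IsConservative) :
    S.Ω₂.orbit (Set.range S.Γ.adjoint) = ⊤ ↔
      ∀ K₂ : ClosedSubmodule ℂ H₂, S.Ω.IsInvariant (directSum ⊥ K₂) → K₂ = ⊥ := by
  refine (orbit_range_eq_top_iff (swap_isConservative hS)).trans (forall_congr' fun K₂ => ?_)
  refine imp_congr_left ⟨fun h => ?_, isInvariant_directSum_swap hS⟩
  have h1 := isInvariant_directSum_swap (swap_isConservative hS) h
  have h2 : S.swap.swap = S :=
    congrArg (CoupledSystem.mk S.Ω₁ S.Ω₂) (ContinuousLinearMap.adjoint_adjoint _)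
  rwa [h2] at h1

end CoupledSystem

end

/-! ### The theorem. -/

theorem mainTheorem2 {H₁ H₂ : Type*}
    [NormedAddCommGroup H₁] [InnerProductSpace ℂ H₁] [CompleteSpace H₁]
    [NormedAddCommGroup H₂] [InnerProductSpace ℂ H₂] [CompleteSpace H₂]
    (S : CoupledSystem H₁ H₂) (hS : S.IsConservative) :
    ∃ (H₁c : ClosedSubmodule ℂ H₁) (H₂c : ClosedSubmodule ℂ H₂),
      -- `H' = H₁c ⊕ H₂c` is the smallest closed subspace that is `Ω`-invariant, splits along `H₁ ⊕ H₂`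
      -- and contains `Ran Γ`
      IsLeast {K | S.IsSplitInvariantContainingRange K} (CoupledSystem.directSum H₁c H₂c) ∧
      -- there is exactly one minimal subspace with these properties
      (∃! K, Minimal S.IsSplitInvariantContainingRange K) ∧
      -- the restriction of `Ω` to `H'` is conservative
      IsSelfAdjoint (S.Ω.restrictTo (CoupledSystem.directSum H₁c H₂c)) ∧
      -- the coupling restricts to `H'`
      (∀ v ∈ H₂c, S.Γ v ∈ H₁c) ∧ (∀ v ∈ H₁c, S.Γ.adjoint v ∈ H₂c) ∧
      -- (i)
      H₁c = S.Ω₁.orbit (Set.range S.Γ) ∧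
      H₂c = S.Ω₂.orbit (Set.range S.Γ.adjoint) ∧
      -- (ii)
      (S.subsystem H₁c H₂c).IsReconstructible ∧
      (∀ K, S.IsMinimalExtensionWithin₁ K ↔ K = CoupledSystem.directSum ⊤ H₂c) ∧
      (∀ K, S.IsMinimalExtensionWithin₂ K ↔ K = CoupledSystem.directSum H₁c ⊤) ∧
      -- the state spaces of these minimal extensions are the orbits of `H₁` and of `H₂`
      S.Ω.orbit (CoupledSystem.directSum (⊤ : ClosedSubmodule ℂ H₁)
        (⊥ : ClosedSubmodule ℂ H₂) : Set (WithLp 2 (H₁ × H₂))) =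
          CoupledSystem.directSum ⊤ H₂c ∧
      S.Ω.orbit (CoupledSystem.directSum (⊥ : ClosedSubmodule ℂ H₁)
        (⊤ : ClosedSubmodule ℂ H₂) : Set (WithLp 2 (H₁ × H₂))) =
          CoupledSystem.directSum H₁c ⊤ ∧
      -- (iii)
      (∀ t : ℝ,
        (∀ v : H₁c.toSubmodule,
          S.a₁ t v = ((S.subsystem H₁c H₂c).a₁ t v : H₁c.toSubmodule)) ∧
        (∀ v ∈ H₁c.toSubmoduleᗮ, S.a₁ t v = 0) ∧
        (∀ v : H₂c.toSubmodule,
          S.a₂ t v = ((S.subsystem H₁c H₂c).a₂ t v : H₂c.toSubmodule)) ∧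
        (∀ v ∈ H₂c.toSubmoduleᗮ, S.a₂ t v = 0)) ∧
      (∀ (K₁ : ClosedSubmodule ℂ H₁) (K₂ : ClosedSubmodule ℂ H₂),
        S.Ω.IsInvariant (CoupledSystem.directSum K₁ K₂) →
        CoupledSystem.directSum K₁ K₂ < CoupledSystem.directSum H₁c H₂c →
        ¬ S.Determines₁ K₁ K₂ ∧ ¬ S.Determines₂ K₁ K₂) ∧
      -- (iv)
      (S.IsReconstructible ↔
        (∀ K₁ : ClosedSubmodule ℂ H₁,
          S.Ω.IsInvariant (CoupledSystem.directSum K₁ ⊥) → K₁ = ⊥) ∧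
        (∀ K₂ : ClosedSubmodule ℂ H₂,
          S.Ω.IsInvariant (CoupledSystem.directSum ⊥ K₂) → K₂ = ⊥)) := by
  have hinv := CoupledSystem.isInvariant_directSum_orbit_orbit hS
  have hleast := CoupledSystem.isLeast_directSum_orbit hS
  have hΓ (w : H₂) : S.Γ w ∈ S.Ω₁.orbit (Set.range S.Γ) := LinearPMap.subset_orbit hS.1 ⟨w, rfl⟩
  have hΓ' (w : H₁) : S.Γ.adjoint w ∈ S.Ω₂.orbit (Set.range S.Γ.adjoint) :=
    LinearPMap.subset_orbit hS.2 ⟨w, rfl⟩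
  refine ⟨S.Ω₁.orbit (Set.range S.Γ), S.Ω₂.orbit (Set.range S.Γ.adjoint), hleast, ?_,
    hinv.isSelfAdjoint_restrictTo (CoupledSystem.isSelfAdjoint_Ω hS), fun v _ => hΓ v,
    fun v _ => hΓ' v, rfl, rfl, ?_, CoupledSystem.isMinimalExtensionWithin₁_iff hS,
    CoupledSystem.isMinimalExtensionWithin₂_iff hS, CoupledSystem.orbit_fst hS,
    CoupledSystem.orbit_snd hS, fun t => ⟨CoupledSystem.a₁_eq_subsystem_a₁ hS hinv t,
      fun v hv => CoupledSystem.a₁_eq_zero hΓ hv t, CoupledSystem.a₂_eq_subsystem_a₂ hS hinv t,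
      fun v hv => CoupledSystem.a₂_eq_zero hΓ' hv t⟩, ?_, ?_⟩
  · exact ⟨_, ⟨hleast.1, fun K hK _ => hleast.2 hK⟩,
      fun K hK => le_antisymm (hK.2 hleast.1 (hleast.2 hK.1)) (hleast.2 hK.1)⟩
  · rw [CoupledSystem.isReconstructible_iff (CoupledSystem.subsystem_isConservative hS
      (LinearPMap.isInvariant_orbit hS.1 _) (LinearPMap.isInvariant_orbit hS.2 _))]
    refine ⟨CoupledSystem.subsystem_orbit_eq_top hS hinv hΓ le_rfl, ?_⟩
    have hswap := CoupledSystem.isInvariant_directSum_swap hS hinv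
    have h := CoupledSystem.subsystem_orbit_eq_top (CoupledSystem.swap_isConservative hS) hswap hΓ'
      (by rw [CoupledSystem.adjoint_swap_Γ]; exact le_rfl)
    rwa [← CoupledSystem.swap_subsystem, CoupledSystem.adjoint_swap_Γ] at h
  · intro K₁ K₂ hK hlt
    refine ⟨fun hdet => ?_, fun hdet => ?_⟩
    · exact hlt.not_ge (CoupledSystem.directSum_orbit_le hS hK (hdet.Γ_mem hS))
    -- Determining `a₂` only gives `Ran Γ† ⊆ K₂`; with `Γ(K₂) ⊆ K₁`, the exchanged system yields
    -- `Ran Γ ⊆ K₁`.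
    · have h4 := ((CoupledSystem.isInvariant_directSum_iff hS).1 hK).2.2.1
      refine hlt.not_ge (CoupledSystem.directSum_orbit_le hS hK fun w => ?_)
      have h := CoupledSystem.adjoint_Γ_mem_of_Γ_mem (S := S.swap) (hdet.adjoint_Γ_mem hS) (by
        rw [CoupledSystem.adjoint_swap_Γ]; exact h4) w
      rwa [CoupledSystem.adjoint_swap_Γ] at h
  · rw [CoupledSystem.isReconstructible_iff hS, CoupledSystem.orbit_range_adjoint_eq_top_iff hS,
      CoupledSystem.orbit_range_eq_top_iff hS, and_comm]
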